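/- Let $S=\mathbb{C}[x,y,z]$ and let $C: f=0$ be a reduced curve of degree $d\ge 3$ in the complex projective plane $\mathbb{P}^2$. Let $d_1\le d_2\le\cdots\le d_m$ be the exponents of $C$, that is, the degrees of a minimal system of homogeneous generators of the graded $S$-module of Jacobian syzygies $\{(a,b,c)\in S^3 : a f_x+b f_y+c f_z=0\}$; one says that $C$ is an $m$-syzygy curve. Let $t(C)=d_1+d_2+1-d$ be the type of $C$, and let $\tau(C)$ be the total Tjurina number of $C$, that is, the sum of the Tjurina numbers of its singular points. If $C$ is not free (i.e. $m\geq 3$), the minimal graded free resolution of the Milnor algebra $M(f)=S/(f_x,f_y,f_z)$ has the form $$0\to\bigoplus_{j=1}^{m-2}S(-c_j)\to\bigoplus_{i=1}^{m}S(1-d-d_i)\to S^3(1-d)\to S,\qquad c_1\le\cdots\le c_{m-2},$$ and one writes $c_j=d+d_{j+2}-1+\epsilon_j$ for $j=1,\dots,m-2$; for an ordered partition $\pi$ of $t\ge 1$, the curve $C$ is said to be of class $tT_\pi$ if $t(C)=t$ and $(\epsilon_1,\dots,\epsilon_{m-2})=\pi$. Assume that $t(C)=4$. Then $d_1+d_2=d+3$,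 and $C$ belongs to exactly one of the following eight classes, corresponding to the eight ordered partitions of $4$: 1. $4T_{(4)}$. Then $m=3$ and $\tau(C)=d_1^2+d_1d_2+d_2^2-4(d_1+d_2+d_3)$. 2. $4T_{(3,1)}$. Then $m=4$, $d_3<d_4-1$ and $\tau(C)=d_1^2+d_1d_2+d_2^2-4d_1-4d_2+3-3d_3-d_4$. 3. $4T_{(2,2)}$. Then $m=4$ and $\tau(C)=d_1^2+d_1d_2+d_2^2-4d_1-4d_2+4-2d_3-2d_4$. 4. $4T_{(1,3)}$. Then $m=4$ and $\tau(C)=d_1^2+d_1d_2+d_2^2-4d_1-4d_2+3-d_3-3d_4$. 5. $4T_{(2,1,1)}$. Then $m=5$, $d_3<d_4$ and $\tau(C)=d_1^2+d_1d_2+d_2^2-4d_1-4d_2+5-2d_3-d_4-d_5$. 6. $4T_{(1,2,1)}$. Then $m=5$, $d_4<d_5$ and $\tau(C)=d_1^2+d_1d_2+d_2^2-4d_1-4d_2+5-d_3-2d_4-d_5$. 7. $4T_{(1,1,2)}$. Then $m=5$ and $\tau(C)=d_1^2+d_1d_2+d_2^2-4d_1-4d_2+5-d_3-d_4-2d_5$.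 8. $4T_{(1,1,1,1)}$. Then $m=6$ and $\tau(C)=d_1^2+d_1d_2+d_2^2-4d_1-4d_2+6-(d_3+d_4+d_5+d_6)$. -/

import Mathlib

open MvPolynomial

noncomputable section

namespace PlaneCurve

/-- The polynomial ring `S = ℂ[x, y, z]`. -/
abbrev S : Type := MvPolynomial (Fin 3) ℂ

/-- The map `S³ → S`, `(a, b, c) ↦ a f_x + b f_y + c f_z`. Its image is the Jacobian ideal `J_f`,
so its cokernel is the Jacobian (Milnor) algebra `M(f) = S / J_f`. -/
def gradMap (f : S) : (Fin 3 → S) →ₗ[S] S :=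
  Fintype.linearCombination S (fun k => pderiv k f)

/-- The graded `S`-module of Jacobian syzygies of `f`:
triples `(a, b, c)` with `a f_x + b f_y + c f_z = 0`. -/
def syzygies (f : S) : Submodule S (Fin 3 → S) :=
  LinearMap.ker (gradMap f)

/-- `d_1 ≤ ⋯ ≤ d_m` (here `e 0 ≤ ⋯ ≤ e (m - 1)`) are the exponents of the curve `f = 0`: the degrees
of the members of a minimal system of homogeneous generators of the module of Jacobian syzygies. -/
def IsExponents (f : S) {m : ℕ} (e : Fin m → ℕ) : Prop :=
  Monotone e ∧ ∃ r : Fin m → (Fin 3 → S),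
    (∀ i k, (r i k).IsHomogeneous (e i)) ∧
    Submodule.span S (Set.range r) = syzygies f ∧
    ∀ i, r i ∉ Submodule.span S (r '' {i}ᶜ)

/-- The curve `f = 0` is an `m`-syzygy curve: it has exactly `m` exponents. -/
def IsSyzygyCurve (f : S) (m : ℕ) : Prop :=
  ∃ e : Fin m → ℕ, IsExponents f e

/-- The curve `f = 0` of degree `d` has type `t`, that is, `d_1 + d_2 + 1 - d = t`. -/
def HasType (f : S) (d t : ℕ) : Prop :=
  ∃ (n : ℕ) (e : Fin (n + 2) → ℕ), IsExponents f e ∧ (e 0 : ℤ) + e 1 + 1 - d = t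

/-- `p` is homogeneous of the integer degree `k` (so `p = 0` when `k < 0`). -/
def IsHomogeneousInt (p : S) (k : ℤ) : Prop :=
  ∀ s ∈ p.support, (s.degree : ℤ) = k

/-- There is a minimal graded free resolution of `M(f)` of the form
`0 → ⨁_j S(-c_j) → ⨁_i S(1 - d - d_i) → S(1 - d)³ → S`,
with `m = n + 2` first syzygies, `n` second syzygies, `d_1 ≤ ⋯ ≤ d_m` and `c_1 ≤ ⋯ ≤ c_n`.
The two maps on the left are the matrices `A` and `B`, and the last one is `gradMap f`. A graded
resolution is minimal when all entries of its matrices lie in the ideal `(x, y, z)`. -/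
def HasMinimalResolution (f : S) (d : ℕ) {n : ℕ} (e : Fin (n + 2) → ℕ) (c : Fin n → ℕ) : Prop :=
  Monotone e ∧ Monotone c ∧
  ∃ (A : Matrix (Fin 3) (Fin (n + 2)) S) (B : Matrix (Fin (n + 2)) (Fin n) S),
    (∀ k i, (A k i).IsHomogeneous (e i)) ∧
    (∀ i j, IsHomogeneousInt (B i j) ((c j : ℤ) - ((d : ℤ) - 1 + e i))) ∧
    Function.Injective B.mulVecLin ∧
    Function.Exact B.mulVecLin A.mulVecLin ∧
    Function.Exact A.mulVecLin (gradMap f) ∧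
    (∀ k, constantCoeff (pderiv k f) = 0) ∧
    (∀ k i, constantCoeff (A k i) = 0) ∧
    (∀ i j, constantCoeff (B i j) = 0)

/-- The ordered partition attached to the curve is `π = (ε_1, …, ε_n)`: in the minimal resolution
of `M(f)` one has `m = n + 2` and `c_j = d + d_{j+2} - 1 + ε_j` for `j = 1, …, n`. -/
def HasPartition (f : S) (d : ℕ) (π : List ℕ) : Prop :=
  ∃ (e : Fin (π.length + 2) → ℕ) (c : Fin π.length → ℕ),
    HasMinimalResolution f d e c ∧
    ∀ j : Fin π.length, (c j : ℤ) = (d : ℤ) + e j.succ.succ - 1 + π.get j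

/-- The curve `f = 0` of degree `d` is in the class `tT_π`. -/
def HasClass (f : S) (d t : ℕ) (π : List ℕ) : Prop :=
  HasType f d t ∧ HasPartition f d π

/-- The maximal ideal of the origin in `ℂ[u, v]`. -/
abbrev originIdeal : Ideal (MvPolynomial (Fin 2) ℂ) :=
  RingHom.ker (constantCoeff : MvPolynomial (Fin 2) ℂ →+* ℂ)

instance : originIdeal.IsPrime :=
  RingHom.ker_isPrime _

/-- The local ring of the affine plane at the origin. -/
abbrev LocalRing : Type :=
  Localization.AtPrime originIdeal

/-- The Tjurina number at the origin of the affine plane curve `g = 0`: the complex dimension of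
the quotient of the local ring at the origin by the ideal `(g, g_u, g_v)`. -/
def tjurinaAtOrigin (g : MvPolynomial (Fin 2) ℂ) : ℕ :=
  Module.finrank ℂ (LocalRing ⧸ Ideal.span
    ({algebraMap _ LocalRing g, algebraMap _ LocalRing (pderiv 0 g),
      algebraMap _ LocalRing (pderiv 1 g)} : Set LocalRing))

/-- The equation of the curve `f = 0` in the affine chart `x_i = 1`, after the translation that
moves the point `[v]` (where `v i ≠ 0`) to the origin. -/
def localEquation (f : S) (v : Fin 3 → ℂ) (i : Fin 3) : MvPolynomial (Fin 2) ℂ :=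
  aeval (i.insertNth (1 : MvPolynomial (Fin 2) ℂ)
    (fun j : Fin 2 => X j + C (v (i.succAbove j) / v i))) f

lemma exists_rep_ne_zero (p : Projectivization ℂ (Fin 3 → ℂ)) : ∃ i, p.rep i ≠ 0 :=
  Function.ne_iff.mp p.rep_nonzero

/-- The Tjurina number of the curve `f = 0` at the point `p` of the projective plane, computed in
a standard affine chart that contains `p`. It vanishes unless `p` is a singular point. -/
def tjurinaAt (f : S) (p : Projectivization ℂ (Fin 3 → ℂ)) : ℕ :=
  tjurinaAtOrigin (localEquation f p.rep (exists_rep_ne_zero p).choose)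

/-- The total Tjurina number `τ(C)`: the sum of the Tjurina numbers at all points of the plane
(the non-zero terms are those at the singular points, finite in number for a reduced curve). -/
def totalTjurina (f : S) : ℕ :=
  ∑ᶠ p : Projectivization ℂ (Fin 3 → ℂ), tjurinaAt f p

end PlaneCurve

end

/-! Put `D = d - 1`. A graded free resolution `0 → ⨁ S(-c_j) → ⨁ S(-D - d_i) → S(-D)³ → S` of `M(f)`
computes `dim M(f)_k`, which for large `k` is a quadratic polynomial in `k`. Since `f` is
squarefree, the Jacobian ideal contains two coprime forms of degree `D` (`exists_isRelPrime`), so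
this dimension is at most `D²` for large `k` (`two_mul_hf_le`). Hence the two leading coefficients
vanish and the polynomial is constant (`resolution_numerics`). The first coefficient gives the
number of second syzygies, the next gives the sum of the `c_j`, and the constant is a difference of
sums of squares of shifts. With `c_j = D + d_{j+2} + ε_j`, the sum of the shifts says exactly that
`∑ ε_j = d_1 + d_2 - D`, which is the type.

Each `ε_j` is positive (`lt_degree_second_syzygy`): otherwise a block of zeros in the matrix of
second syzygies would produce a relation between the two generators of lowest degree, and these are
independent. So the `ε_j` form an ordered partition of 4, one of eight. Monotonicity of the `c_j`
yields the strict inequalities between exponents.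

The constant value of `dim M(f)_k` is the total Tjurina number (`exists_totalTjurina_add`). Forms of
large degree take arbitrary jets at finitely many points, so they surject onto the product of the
local Tjurina algebras. The kernel consists of the forms lying locally in the Jacobian ideal; by the
Nullstellensatz they lie in its saturation, which agrees with the ideal itself in large degrees.

A class exists because the second syzygies are free (`IsMinimalMatrix.injective`, Hilbert's syzygy
theorem in three variables). It is unique because the degrees of minimal generators are determined
by the module, and the `c_j` by the Hilbert function. -/

namespace PlaneCurve

/-! ### Homogeneous components in integer degrees -/

/-- The homogeneous component of integer degree `k`. -/
noncomputable def hcomp (k : ℤ) : S →ₗ[ℂ] S :=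
  if 0 ≤ k then homogeneousComponent k.toNat else 0

lemma coeff_hcomp (k : ℤ) (p : S) (s : Fin 3 →₀ ℕ) :
    coeff s (hcomp k p) = if (s.degree : ℤ) = k then coeff s p else 0 := by
  unfold hcomp
  split_ifs with h1 h2 h2
  · rw [coeff_homogeneousComponent, if_pos (by omega)]
  · rw [coeff_homogeneousComponent, if_neg (by omega)]
  · omega
  · simp

lemma isHomogeneousInt_iff {p : S} {k : ℤ} :
    IsHomogeneousInt p k ↔ ∀ s : Fin 3 →₀ ℕ, (s.degree : ℤ) ≠ k → coeff s p = 0 := by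
  simp only [IsHomogeneousInt, mem_support_iff]
  exact forall_congr' fun s => by tauto

lemma isHomogeneousInt_natCast {p : S} {k : ℕ} : IsHomogeneousInt p k ↔ p.IsHomogeneous k := by
  rw [isHomogeneousInt_iff]
  constructor
  · intro h s hs
    have : (s.degree : ℤ) = k := by
      by_contra h'
      exact hs (h s h')
    exact (DFunLike.congr_fun Finsupp.degree_eq_weight_one s).symm.trans (by exact_mod_cast this)
  · intro h s hs
    exact h.coeff_eq_zero (by exact_mod_cast hs)

lemma isHomogeneousInt_hcomp (k : ℤ) (p : S) : IsHomogeneousInt (hcomp k p) k := by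
  rw [isHomogeneousInt_iff]
  intro s hs
  rw [coeff_hcomp, if_neg hs]

lemma isHomogeneousInt_zero (k : ℤ) : IsHomogeneousInt 0 k := by
  simp [IsHomogeneousInt]

lemma IsHomogeneousInt.add {p q : S} {k : ℤ} (hp : IsHomogeneousInt p k)
    (hq : IsHomogeneousInt q k) : IsHomogeneousInt (p + q) k := by
  rw [isHomogeneousInt_iff] at *
  intro s hs
  rw [coeff_add, hp s hs, hq s hs, add_zero]

lemma IsHomogeneousInt.smul {p : S} {k : ℤ} (hp : IsHomogeneousInt p k) (a : ℂ) :
    IsHomogeneousInt (a • p) k := by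
  rw [isHomogeneousInt_iff] at *
  intro s hs
  rw [coeff_smul, hp s hs, smul_zero]

lemma IsHomogeneousInt.eq_zero_of_neg {p : S} {k : ℤ} (hp : IsHomogeneousInt p k) (hk : k < 0) :
    p = 0 := by
  rw [isHomogeneousInt_iff] at hp
  ext s
  rw [hp s (by omega), coeff_zero]

lemma IsHomogeneousInt.hcomp_eq {p : S} {k : ℤ} (hp : IsHomogeneousInt p k) : hcomp k p = p := by
  rw [isHomogeneousInt_iff] at hp
  ext s
  rw [coeff_hcomp]
  split_ifs with h
  · rfl
  · exact (hp s h).symm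

/-- In each coefficient of the product only the terms with second exponent of degree `l` survive,
and there the first exponent has degree `k` exactly when the total degree is `k + l`. -/
lemma hcomp_mul {q : S} {l : ℤ} (hq : IsHomogeneousInt q l) (k : ℤ) (p : S) :
    hcomp (k + l) (p * q) = hcomp k p * q := by
  rw [isHomogeneousInt_iff] at hq
  ext s
  rw [coeff_hcomp, coeff_mul, coeff_mul]
  have key : ∀ x ∈ Finset.HasAntidiagonal.antidiagonal s, coeff x.1 (hcomp k p) * coeff x.2 q =
      if (s.degree : ℤ) = k + l then coeff x.1 p * coeff x.2 q else 0 := by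
    intro x hx
    rw [coeff_hcomp]
    by_cases h2 : (x.2.degree : ℤ) = l
    · have : x.1.degree + x.2.degree = s.degree := by
        rw [← Finset.HasAntidiagonal.mem_antidiagonal.mp hx, map_add]
      by_cases h1 : (x.1.degree : ℤ) = k
      · rw [if_pos h1, if_pos (by omega)]
      · rw [if_neg h1, if_neg (by omega), zero_mul]
    · simp [hq _ h2]
  rw [Finset.sum_congr rfl key]
  split_ifs <;> simp

lemma IsHomogeneousInt.mul {p q : S} {k l : ℤ} (hp : IsHomogeneousInt p k)
    (hq : IsHomogeneousInt q l) : IsHomogeneousInt (p * q) (k + l) := by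
  rw [← hp.hcomp_eq, ← hcomp_mul hq]
  exact isHomogeneousInt_hcomp _ _

lemma IsHomogeneousInt.constantCoeff_eq_zero {p : S} {k : ℤ} (hp : IsHomogeneousInt p k)
    (hk : k ≠ 0) : constantCoeff p = 0 := by
  rw [isHomogeneousInt_iff] at hp
  exact hp 0 (by simpa using hk.symm)

lemma IsHomogeneousInt.eq_C {p : S} (hp : IsHomogeneousInt p 0) : p = C (constantCoeff p) := by
  rw [isHomogeneousInt_iff] at hp
  ext s
  rw [coeff_C]
  split_ifs with h
  · rw [← h, constantCoeff_eq]
  · apply hp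
    intro h'
    exact h ((Finsupp.degree_eq_zero_iff s).mp (by exact_mod_cast h')).symm

/-! ### Graded pieces of twisted free modules -/

section
variable {ι κ : Type*}

/-- The graded piece of degree `k` of the twisted free module `⨁ i, S(-w i)`. -/
def piece (w : ι → ℕ) (k : ℕ) : Submodule ℂ (ι → S) where
  carrier := {v | ∀ i, IsHomogeneousInt (v i) ((k : ℤ) - w i)}
  zero_mem' := fun _ => isHomogeneousInt_zero _
  add_mem' := fun ha hb i => (ha i).add (hb i)
  smul_mem' := fun a _ hv i => (hv i).smul a

/-- The projection of `⨁ i, S(-w i)` to its graded piece of degree `k`. -/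
noncomputable def vcomp (w : ι → ℕ) (k : ℕ) : (ι → S) →ₗ[ℂ] (ι → S) :=
  LinearMap.pi fun i => hcomp ((k : ℤ) - w i) ∘ₗ LinearMap.proj i

lemma vcomp_apply (w : ι → ℕ) (k : ℕ) (v : ι → S) (i : ι) :
    vcomp w k v i = hcomp ((k : ℤ) - w i) (v i) := rfl

lemma vcomp_mem_piece (w : ι → ℕ) (k : ℕ) (v : ι → S) : vcomp w k v ∈ piece w k :=
  fun _ => isHomogeneousInt_hcomp _ _

lemma vcomp_eq_self {w : ι → ℕ} {k : ℕ} {v : ι → S} (hv : v ∈ piece w k) : vcomp w k v = v :=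
  funext fun i => (hv i).hcomp_eq

/-- A matrix defines a degree-preserving map `⨁ j, S(-w' j) → ⨁ i, S(-w i)`. -/
def IsGradedMatrix (w : ι → ℕ) (w' : κ → ℕ) (M : Matrix ι κ S) : Prop :=
  ∀ i j, IsHomogeneousInt (M i j) ((w' j : ℤ) - w i)

lemma IsGradedMatrix.vcomp_mulVec [Fintype κ] {w : ι → ℕ} {w' : κ → ℕ} {M : Matrix ι κ S}
    (hM : IsGradedMatrix w w' M) (k : ℕ) (v : κ → S) :
    vcomp w k (M.mulVec v) = M.mulVec (vcomp w' k v) := by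
  funext i
  simp only [vcomp_apply, Matrix.mulVec, dotProduct, map_sum]
  refine Finset.sum_congr rfl fun j _ => ?_
  rw [mul_comm, mul_comm (M i j), ← hcomp_mul (hM i j)]
  congr 2
  ring

lemma IsGradedMatrix.mulVec_mem [Fintype κ] {w : ι → ℕ} {w' : κ → ℕ} {M : Matrix ι κ S}
    (hM : IsGradedMatrix w w' M) {k : ℕ} {v : κ → S} (hv : v ∈ piece w' k) :
    M.mulVec v ∈ piece w k := by
  rw [← vcomp_eq_self hv, ← hM.vcomp_mulVec]
  exact vcomp_mem_piece _ _ _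

lemma exists_eq_sum_vcomp [Fintype ι] (w : ι → ℕ) (v : ι → S) :
    ∃ n, v = ∑ k ∈ Finset.range n, vcomp w k v := by
  refine ⟨∑ i, (w i + (v i).totalDegree) + 1, funext fun i => ?_⟩
  ext s
  rw [Finset.sum_apply, coeff_sum]
  simp only [vcomp_apply, coeff_hcomp]
  by_cases hs : coeff s (v i) = 0
  · simp [hs]
  have h1 : s.degree ≤ (v i).totalDegree := by
    rw [Finsupp.degree_eq_sum]
    have := le_totalDegree (mem_support_iff.mpr hs)
    rwa [Finsupp.sum_fintype _ _ (fun _ => rfl)] at this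
  have h2 : w i + (v i).totalDegree ≤ ∑ i, (w i + (v i).totalDegree) :=
    Finset.single_le_sum (f := fun i => w i + (v i).totalDegree) (fun _ _ => Nat.zero_le _)
      (Finset.mem_univ i)
  -- A monomial `s` in coordinate `i` occurs in the piece of degree `s.degree + w i` and in no
  -- other.
  rw [Finset.sum_eq_single (s.degree + w i)]
  · simp
  · intro k _ hk
    rw [if_neg (by omega)]
  · intro h
    simp only [Finset.mem_range] at h
    omega

end

/-- The dimension of the graded piece of degree `k` of `S(-a)`. -/
def hf (k a : ℕ) : ℕ := if a ≤ k then (k - a + 2).choose 2 else 0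

lemma two_mul_hf {k a : ℕ} (h : a ≤ k) :
    2 * (hf k a : ℤ) = ((k : ℤ) - a + 1) * (k - a + 2) := by
  rw [hf, if_pos h]
  obtain ⟨b, rfl⟩ := Nat.exists_eq_add_of_le h
  have : a + b - a = b := by omega
  rw [this]
  have h3 : (b + 2).choose 2 * 2 = (b + 2) * (b + 1) := by
    rw [Nat.choose_two_right, Nat.div_mul_cancel]
    · simp
    · exact (Nat.even_mul_pred_self (b + 2)).two_dvd
  have h4 : ((b + 2).choose 2 : ℤ) * 2 = (b + 2) * (b + 1) := by exact_mod_cast h3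
  push_cast
  linear_combination h4

instance (n : ℕ) : FiniteDimensional ℂ (homogeneousSubmodule (Fin 3) ℂ n) :=
  Module.Finite.iff_fg.mpr (homogeneousSubmodule_fg _ _ n)

/-- The monomials of degree `n` form a basis; they are counted by stars and bars. -/
lemma finrank_homogeneousSubmodule (n : ℕ) :
    Module.finrank ℂ (homogeneousSubmodule (Fin 3) ℂ n) = (n + 2).choose 2 := by
  let T : Finset (Fin 3 →₀ ℕ) := Finset.univ.finsuppAntidiag n
  have hT : ∀ s, s ∈ T ↔ s.degree = n := by
    intro s
    simp [T, Finset.mem_finsuppAntidiag, Finsupp.degree_eq_sum]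
  have hli : LinearIndependent ℂ (fun s : T => monomial (s : Fin 3 →₀ ℕ) (1 : ℂ)) := by
    have := (basisMonomials (Fin 3) ℂ).linearIndependent.comp (fun s : T => (s : Fin 3 →₀ ℕ))
      Subtype.val_injective
    simpa [Function.comp_def] using this
  have hspan : homogeneousSubmodule (Fin 3) ℂ n =
      Submodule.span ℂ (Set.range fun s : T => monomial (s : Fin 3 →₀ ℕ) (1 : ℂ)) := by
    apply le_antisymm
    · intro p hp
      rw [p.as_sum]
      refine Submodule.sum_mem _ fun s hs => ?_
      have hs' : s ∈ T := by
        rw [hT]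
        by_contra h
        exact (mem_support_iff.mp hs) (IsHomogeneous.coeff_eq_zero hp h)
      rw [← mul_one (coeff s p), ← smul_eq_mul, ← smul_monomial]
      exact Submodule.smul_mem _ _ (Submodule.subset_span ⟨⟨s, hs'⟩, rfl⟩)
    · rw [Submodule.span_le]
      rintro _ ⟨s, rfl⟩
      exact isHomogeneous_monomial _ ((hT _).mp s.2)
  rw [hspan, finrank_span_eq_card hli, Fintype.card_coe, Finset.card_finsuppAntidiag_nat_eq_choose]
  simp only [Finset.card_univ, Fintype.card_fin]
  rw [show 3 + n - 1 = n + 2 by omega]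
  exact Nat.choose_symm_add

/-- Polynomials that are homogeneous of a given integer degree. -/
def homogeneousInt (k : ℤ) : Submodule ℂ S where
  carrier := {p | IsHomogeneousInt p k}
  zero_mem' := isHomogeneousInt_zero _
  add_mem' := fun ha hb => ha.add hb
  smul_mem' := fun a _ hv => hv.smul a

lemma homogeneousInt_natCast (k : ℕ) : homogeneousInt k = homogeneousSubmodule (Fin 3) ℂ k :=
  SetLike.ext fun _ => isHomogeneousInt_natCast

lemma homogeneousInt_of_neg {k : ℤ} (hk : k < 0) : homogeneousInt k = ⊥ :=
  (Submodule.eq_bot_iff _).mpr fun _ hp => IsHomogeneousInt.eq_zero_of_neg hp hk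

instance (k : ℤ) : FiniteDimensional ℂ (homogeneousInt k) := by
  rcases lt_or_ge k 0 with h | h
  · rw [homogeneousInt_of_neg h]
    infer_instance
  · lift k to ℕ using h
    rw [homogeneousInt_natCast]
    infer_instance

lemma finrank_homogeneousInt (k a : ℕ) :
    Module.finrank ℂ (homogeneousInt ((k : ℤ) - a)) = hf k a := by
  rw [hf]
  split_ifs with h
  · rw [← Nat.cast_sub h, homogeneousInt_natCast, finrank_homogeneousSubmodule]
  · rw [homogeneousInt_of_neg (by omega), finrank_bot]

section
variable {ι : Type*}

/-- A graded piece of a twisted free module is a product of graded pieces of `S`. -/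
def pieceEquiv (w : ι → ℕ) (k : ℕ) :
    piece w k ≃ₗ[ℂ] (∀ i, homogeneousInt ((k : ℤ) - w i)) where
  toFun v i := ⟨v.1 i, v.2 i⟩
  invFun v := ⟨fun i => (v i).1, fun i => (v i).2⟩
  map_add' _ _ := rfl
  map_smul' _ _ := rfl
  left_inv _ := rfl
  right_inv _ := rfl

variable [Fintype ι]

instance (w : ι → ℕ) (k : ℕ) : FiniteDimensional ℂ (piece w k) :=
  Module.Finite.equiv (pieceEquiv w k).symm

lemma finrank_piece (w : ι → ℕ) (k : ℕ) : Module.finrank ℂ (piece w k) = ∑ i, hf k (w i) := by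
  rw [(pieceEquiv w k).finrank_eq, Module.finrank_pi_fintype]
  exact Finset.sum_congr rfl fun i _ => finrank_homogeneousInt k (w i)

end

/-- Rank–nullity for `g` restricted to `p`. Image and kernel stay inside the ambient spaces, so that
the image under one map of a complex can be compared with the kernel of the next. -/
lemma finrank_map_add_finrank_inf_ker {V W : Type*} [AddCommGroup V] [Module ℂ V] [AddCommGroup W]
    [Module ℂ W] (g : V →ₗ[ℂ] W) (p : Submodule ℂ V) [FiniteDimensional ℂ p] :
    Module.finrank ℂ (p.map g) + Module.finrank ℂ (p ⊓ LinearMap.ker g : Submodule ℂ V) =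
      Module.finrank ℂ p := by
  have h := LinearMap.finrank_range_add_finrank_ker (g.domRestrict p)
  rw [LinearMap.range_domRestrict] at h
  rw [← h, LinearMap.ker_domRestrict, inf_comm]
  congr 1
  rw [← Submodule.finrank_map_subtype_eq, Submodule.map_comap_subtype, inf_comm]

/-! ### Minimal systems of homogeneous generators -/

section
variable {ι κ κ' : Type*}

lemma IsGradedMatrix.col_mem_piece {w : ι → ℕ} {e : κ → ℕ} {A : Matrix ι κ S}
    (hA : IsGradedMatrix w e A) (j : κ) : A.col j ∈ piece w (e j) :=
  fun i => hA i j

variable [Fintype κ] [Fintype κ']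

/-- All relations between the columns of the matrix have coefficients in the maximal ideal
`(x, y, z)`. -/
def IsMinimalMatrix (A : Matrix ι κ S) : Prop :=
  ∀ a : κ → S, A.mulVec a = 0 → ∀ j, constantCoeff (a j) = 0

lemma mulVec_eq_sum_col (A : Matrix ι κ S) (a : κ → S) :
    A.mulVec a = ∑ j, a j • A.col j := by
  funext i
  simp [Matrix.mulVec, dotProduct, mul_comm]

/-- In the component of degree `e j` of a relation, the coefficient of column `j` is a scalar. Were
it nonzero, dividing by it would express this column through the others. -/
lemma IsGradedMatrix.isMinimalMatrix {w : ι → ℕ} {e : κ → ℕ} {A : Matrix ι κ S}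
    (hA : IsGradedMatrix w e A) (h : ∀ j, A.col j ∉ Submodule.span S (A.col '' {j}ᶜ)) :
    IsMinimalMatrix A := by
  classical
  intro a ha j
  by_contra hc
  apply h j
  have hb : A.mulVec (vcomp e (e j) a) = 0 := by
    rw [← hA.vcomp_mulVec, ha, map_zero]
  set b := vcomp e (e j) a with hbdef
  have hbj : b j = C (constantCoeff (a j)) := by
    rw [hbdef, vcomp_apply, sub_self, (isHomogeneousInt_hcomp 0 (a j)).eq_C]
    congr 1
    rw [constantCoeff_eq, coeff_hcomp]
    simp
  rw [mulVec_eq_sum_col, ← Finset.add_sum_erase _ _ (Finset.mem_univ j), hbj] at hb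
  have h1 : A.col j =
      (C (constantCoeff (a j))⁻¹ : S) • -∑ i ∈ Finset.univ.erase j, b i • A.col i := by
    rw [← eq_neg_of_add_eq_zero_left hb, smul_smul, ← C_mul, inv_mul_cancel₀ hc, C_1, one_smul]
  rw [h1]
  refine Submodule.smul_mem _ _ (Submodule.neg_mem _ (Submodule.sum_mem _ fun i hi => ?_))
  exact Submodule.smul_mem _ _ (Submodule.subset_span ⟨i, Finset.ne_of_mem_erase hi, rfl⟩)

/-- Expressing column `j` through the others would give a relation with coefficient `-1` at `j`. -/
lemma IsMinimalMatrix.col_notMem {A : Matrix ι κ S} (hA : IsMinimalMatrix A) (j : κ) :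
    A.col j ∉ Submodule.span S (A.col '' {j}ᶜ) := by
  classical
  intro h
  rw [Finsupp.mem_span_image_iff_linearCombination] at h
  obtain ⟨l, hl, hlj⟩ := h
  have hl0 : l j = 0 := by
    by_contra h0
    exact (Finsupp.mem_supported _ _).mp hl (Finsupp.mem_support_iff.mpr h0) rfl
  have := hA (⇑l - Pi.single j 1) (by
    rw [Matrix.mulVec_sub, Matrix.mulVec_single_one, sub_eq_zero, mulVec_eq_sum_col, ← hlj,
      Finsupp.linearCombination_apply,
      Finsupp.sum_fintype l (fun i a => a • A.col i) (fun _ => zero_smul _ _)]) j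
  simp [hl0] at this

lemma range_mulVecLin_eq_span (A : Matrix ι κ S) :
    LinearMap.range A.mulVecLin = Submodule.span S (Set.range A.col) :=
  Matrix.range_mulVecLin A

/-- Write the columns of each matrix through those of the other: `A' = A Q` and `A = A' P`. Then `A
(Q P - 1) = 0`, so minimality makes `Q P` the identity modulo `(x, y, z)`, and a rank comparison
over `ℂ` bounds its size. -/
lemma IsMinimalMatrix.card_le {A : Matrix ι κ S} {A' : Matrix ι κ' S} (hA : IsMinimalMatrix A)
    (h : LinearMap.range A.mulVecLin = LinearMap.range A'.mulVecLin) :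
    Fintype.card κ ≤ Fintype.card κ' := by
  classical
  have h1 : ∀ j, ∃ a, A.mulVec a = A'.col j := by
    intro j
    have : A'.col j ∈ LinearMap.range A.mulVecLin := by
      rw [h, range_mulVecLin_eq_span]
      exact Submodule.subset_span ⟨j, rfl⟩
    exact this
  have h2 : ∀ j, ∃ a, A'.mulVec a = A.col j := by
    intro j
    have : A.col j ∈ LinearMap.range A'.mulVecLin := by
      rw [← h, range_mulVecLin_eq_span]
      exact Submodule.subset_span ⟨j, rfl⟩
    exact this
  choose q hq using h1
  choose p hp using h2
  let Q : Matrix κ κ' S := fun i j => q j i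
  let P : Matrix κ' κ S := fun i j => p j i
  have hQ : A * Q = A' := by
    refine Matrix.ext fun i j => ?_
    exact congrFun (hq j) i
  have hP : A' * P = A := by
    refine Matrix.ext fun i j => ?_
    exact congrFun (hp j) i
  have hcc : (Q * P).map (constantCoeff : S →+* ℂ) = 1 := by
    ext i j
    have h0 : A.mulVec ((Q * P - 1).col j) = 0 := by
      have : A * (Q * P - 1) = 0 := by
        rw [Matrix.mul_sub, Matrix.mul_one, ← Matrix.mul_assoc, hQ, hP, sub_self]
      funext i
      exact congrFun (congrFun this i) j
    have := hA _ h0 i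
    rw [Matrix.map_apply]
    simp only [Matrix.col_apply, Matrix.sub_apply, map_sub, sub_eq_zero] at this
    rw [this, Matrix.one_apply, Matrix.one_apply]
    split_ifs <;> simp
  rw [Matrix.map_mul] at hcc
  have hr : (1 : Matrix κ κ ℂ).rank = Fintype.card κ := Matrix.rank_one
  rw [← hr, ← hcc]
  exact (Matrix.rank_mul_le_left _ _).trans (Matrix.rank_le_card_width _)

lemma submatrix_mulVec_comp (A : Matrix ι κ S) (p : κ → Prop) [DecidablePred p] {b : κ → S}
    (hb : ∀ i, ¬ p i → b i = 0) :
    (A.submatrix id (Subtype.val : {i // p i} → κ)).mulVec (b ∘ Subtype.val) = A.mulVec b := by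
  funext i
  simp only [Matrix.mulVec, dotProduct, Matrix.submatrix_apply, id, Function.comp]
  rw [← Finset.sum_filter_of_ne (p := p) (fun j _ hj => by
    by_contra hp
    exact hj (by rw [hb j hp, mul_zero]))]
  exact (Finset.sum_subtype _ (by simp) (fun j => A i j * b j)).symm

lemma IsMinimalMatrix.submatrix {A : Matrix ι κ S} (hA : IsMinimalMatrix A) (p : κ → Prop)
    [DecidablePred p] : IsMinimalMatrix (A.submatrix id (Subtype.val : {i // p i} → κ)) := by
  intro a ha j
  let b : κ → S := fun i => if h : p i then a ⟨i, h⟩ else 0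
  have hba : b ∘ Subtype.val = a := by
    funext i
    simp [b, i.2]
  have := hA b (by
    rw [← submatrix_mulVec_comp A p (fun i hi => by simp [b, hi]), hba, ha]) j
  simpa [b, j.2] using this

/-- A homogeneous element of the column space of a graded matrix is a combination of the columns
whose degrees do not exceed its own. -/
lemma IsGradedMatrix.exists_mem_piece {w : ι → ℕ} {e : κ → ℕ} {A : Matrix ι κ S}
    (hA : IsGradedMatrix w e A) {k : ℕ} {v : ι → S} (hv : v ∈ piece w k)
    (h : v ∈ LinearMap.range A.mulVecLin) : ∃ b ∈ piece e k, A.mulVec b = v := by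
  obtain ⟨a, rfl⟩ := h
  refine ⟨vcomp e k a, vcomp_mem_piece _ _ _, ?_⟩
  rw [← hA.vcomp_mulVec]
  exact vcomp_eq_self hv

lemma eq_zero_of_mem_piece {w : ι → ℕ} {k : ℕ} {v : ι → S} (hv : v ∈ piece w k) {i : ι}
    (hi : k < w i) : v i = 0 :=
  (hv i).eq_zero_of_neg (by omega)

/-- A column of degree at most `k` can only involve generators of degree at most `k`. Thus the span
of the generators up to degree `k` does not depend on the chosen system. -/
lemma IsGradedMatrix.range_submatrix_le {w : ι → ℕ} {e : κ → ℕ} {e' : κ' → ℕ} {A : Matrix ι κ S}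
    {A' : Matrix ι κ' S} (hA : IsGradedMatrix w e A) (hA' : IsGradedMatrix w e' A')
    (h : LinearMap.range A.mulVecLin = LinearMap.range A'.mulVecLin) (k : ℕ) :
    LinearMap.range (A.submatrix id (Subtype.val : {i // e i ≤ k} → κ)).mulVecLin ≤
      LinearMap.range (A'.submatrix id (Subtype.val : {i // e' i ≤ k} → κ')).mulVecLin := by
  rw [range_mulVecLin_eq_span, Submodule.span_le]
  rintro _ ⟨⟨j, hj⟩, rfl⟩
  have hmem : A.col j ∈ LinearMap.range A'.mulVecLin := by
    rw [← h, range_mulVecLin_eq_span]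
    exact Submodule.subset_span ⟨j, rfl⟩
  obtain ⟨b, hb, hbA⟩ := hA'.exists_mem_piece (hA.col_mem_piece j) hmem
  refine ⟨b ∘ Subtype.val, ?_⟩
  rw [Matrix.mulVecLin_apply, submatrix_mulVec_comp A' (fun i => e' i ≤ k)
    (fun i hi => eq_zero_of_mem_piece hb (by omega)), hbA]
  rfl

end

lemma monotone_eq_of_card_le_eq {m : ℕ} {e e' : Fin m → ℕ} (he : Monotone e) (he' : Monotone e')
    (h : ∀ k, Fintype.card {i // e i ≤ k} = Fintype.card {i // e' i ≤ k}) : e = e' := by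
  have key : ∀ {e e' : Fin m → ℕ}, Monotone e → Monotone e' →
      (∀ k, Fintype.card {i // e i ≤ k} = Fintype.card {i // e' i ≤ k}) → ∀ i, e i ≤ e' i := by
    intro e e' he he' h i
    by_contra! hlt
    -- At the level `e' i` at most `i` entries of `e` have been reached, but at least `i + 1`
    -- entries of `e'`.
    have h1 : Fintype.card {j // e j ≤ e' i} ≤ Fintype.card {j : Fin m // j < i} :=
      Fintype.card_subtype_mono _ _ fun j hj => by
        by_contra! hji
        have := he hji
        have : e j ≤ e' i := hj
        omega
    have h2 : Fintype.card {j : Fin m // j ≤ i} ≤ Fintype.card {j // e' j ≤ e' i} :=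
      Fintype.card_subtype_mono _ _ fun j hj => he' hj
    rw [h (e' i)] at h1
    have h3 : Fintype.card {j : Fin m // j < i} = i := by
      rw [Fintype.card_subtype, Finset.filter_gt_eq_Iio, Fin.card_Iio]
    have h4 : Fintype.card {j : Fin m // j ≤ i} = i + 1 := by
      rw [Fintype.card_subtype, Finset.filter_ge_eq_Iic, Fin.card_Iic]
    omega
  exact funext fun i => le_antisymm (key he he' h i) (key he' he (fun k => (h k).symm) i)

/-- The degrees of a minimal system of homogeneous generators are well defined. -/
lemma degrees_unique {ι : Type*} {m m' : ℕ} {w : ι → ℕ} {e : Fin m → ℕ} {e' : Fin m' → ℕ}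
    {A : Matrix ι (Fin m) S} {A' : Matrix ι (Fin m') S} (he : Monotone e) (he' : Monotone e')
    (hA : IsGradedMatrix w e A) (hA' : IsGradedMatrix w e' A') (hm : IsMinimalMatrix A)
    (hm' : IsMinimalMatrix A')
    (h : LinearMap.range A.mulVecLin = LinearMap.range A'.mulVecLin) :
    ∃ hmm : m = m', ∀ i, e i = e' (Fin.cast hmm i) := by
  have h1 := hm.card_le h
  have h2 := hm'.card_le h.symm
  simp only [Fintype.card_fin] at h1 h2
  obtain rfl := le_antisymm h1 h2
  refine ⟨rfl, fun i => ?_⟩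
  rw [Fin.cast_refl, id]
  refine congrFun (monotone_eq_of_card_le_eq he he' fun k => ?_) i
  have hr := le_antisymm (hA.range_submatrix_le hA' h k) (hA'.range_submatrix_le hA h.symm k)
  exact le_antisymm ((hm.submatrix _).card_le hr) ((hm'.submatrix _).card_le hr.symm)

/-! ### Jacobian syzygies and exponents -/

lemma gradMap_apply (f : S) (v : Fin 3 → S) : gradMap f v = ∑ k, v k * pderiv k f := by
  simp [gradMap, Fintype.linearCombination_apply]

lemma isGradedMatrix_add_iff {ι κ : Type*} {e : κ → ℕ} {A : Matrix ι κ S} (D : ℕ) :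
    IsGradedMatrix (fun _ => D) (fun j => D + e j) A ↔ ∀ i j, (A i j).IsHomogeneous (e j) := by
  refine forall_congr' fun i => forall_congr' fun j => ?_
  rw [← isHomogeneousInt_natCast]
  simp

lemma IsExponents.exists_matrix {f : S} {m : ℕ} {e : Fin m → ℕ} (h : IsExponents f e) (D : ℕ) :
    ∃ A : Matrix (Fin 3) (Fin m) S, IsGradedMatrix (fun _ => D) (fun j => D + e j) A ∧
      IsMinimalMatrix A ∧ LinearMap.range A.mulVecLin = syzygies f := by
  obtain ⟨-, r, hr, hspan, hirr⟩ := h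
  have hA : IsGradedMatrix (fun _ => D) (fun j => D + e j)
      (Matrix.of fun k i => r i k : Matrix (Fin 3) (Fin m) S) :=
    (isGradedMatrix_add_iff D).mpr fun i j => hr j i
  exact ⟨_, hA, hA.isMinimalMatrix hirr, by rw [range_mulVecLin_eq_span, ← hspan]; rfl⟩

lemma isExponents_of_matrix {f : S} {m : ℕ} {e : Fin m → ℕ} {A : Matrix (Fin 3) (Fin m) S}
    (he : Monotone e) (hA : ∀ i j, (A i j).IsHomogeneous (e j)) (hm : IsMinimalMatrix A)
    (hr : LinearMap.range A.mulVecLin = syzygies f) : IsExponents f e :=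
  ⟨he, A.col, fun i k => hA k i, by rw [← hr, range_mulVecLin_eq_span], hm.col_notMem⟩

lemma IsExponents.unique {f : S} {m m' : ℕ} {e : Fin m → ℕ} {e' : Fin m' → ℕ}
    (h : IsExponents f e) (h' : IsExponents f e') :
    ∃ hmm : m = m', ∀ i, e i = e' (Fin.cast hmm i) := by
  obtain ⟨A, hA, hm, hr⟩ := h.exists_matrix 0
  obtain ⟨A', hA', hm', hr'⟩ := h'.exists_matrix 0
  simp only [zero_add] at hA hA'
  exact degrees_unique h.1 h'.1 hA hA' hm hm' (hr.trans hr'.symm)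

lemma mem_syzygies_of_smul {f : S} {p : S} (hp : p ≠ 0) {s : Fin 3 → S}
    (h : p • s ∈ syzygies f) : s ∈ syzygies f := by
  rw [syzygies, LinearMap.mem_ker, map_smul, smul_eq_mul] at h
  exact (mul_eq_zero.mp h).resolve_left hp

lemma IsMinimalMatrix.col_ne_zero {ι κ : Type*} [Fintype κ] {A : Matrix ι κ S}
    (hA : IsMinimalMatrix A) (j : κ) : A.col j ≠ 0 := fun h =>
  hA.col_notMem j (h ▸ Submodule.zero_mem _)

/-- The two minimal generators of lowest degree of a saturated graded submodule are linearly
independent. -/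
lemma IsMinimalMatrix.independent {ι : Type*} {n : ℕ} {e : Fin (n + 2) → ℕ}
    {A : Matrix ι (Fin (n + 2)) S} (hA : ∀ i j, (A i j).IsHomogeneous (e j)) (he : Monotone e)
    (hm : IsMinimalMatrix A)
    (hsat : ∀ (p : S) (s : ι → S), p ≠ 0 → p • s ∈ LinearMap.range A.mulVecLin →
      s ∈ LinearMap.range A.mulVecLin)
    {p q : S} (hpq : p • A.col 0 + q • A.col 1 = 0) : p = 0 ∧ q = 0 := by
  have h01 : (0 : Fin (n + 2)) ≠ 1 := by simp
  by_cases hp : p = 0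
  · rw [hp, zero_smul, zero_add, smul_eq_zero] at hpq
    exact ⟨hp, hpq.resolve_right (hm.col_ne_zero 1)⟩
  exfalso
  -- After cancelling the common factor, `p'` is coprime to `q'` and divides column 1. Both columns
  -- are then multiples of a single `s`, which lies in the module by saturation.
  obtain ⟨p', q', c, hrel, rfl, rfl⟩ := UniqueFactorizationMonoid.exists_reduced_factors p hp q
  have hc : c ≠ 0 := left_ne_zero_of_mul hp
  have hp' : p' ≠ 0 := right_ne_zero_of_mul hp
  rw [mul_smul, mul_smul, ← smul_add, smul_eq_zero] at hpq
  replace hpq := hpq.resolve_left hc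
  have hdvd : ∀ k, p' ∣ A.col 1 k := by
    intro k
    refine hrel.dvd_of_dvd_mul_left (y := q') (z := A.col 1 k) ?_
    have := congrFun hpq k
    simp only [Pi.add_apply, Pi.smul_apply, smul_eq_mul, Pi.zero_apply] at this
    exact ⟨-A.col 0 k, by linear_combination this⟩
  choose s hs using hdvd
  have hs1 : A.col 1 = p' • s := funext hs
  have hs0 : A.col 0 = -q' • s := by
    have : p' • (A.col 0 + q' • s) = 0 := by
      rw [smul_add, smul_comm, ← hs1, hpq]
    have := (smul_eq_zero.mp this).resolve_left hp'
    rw [neg_smul]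
    exact eq_neg_of_add_eq_zero_left this
  have hq' : q' ≠ 0 := by
    rintro rfl
    exact hm.col_ne_zero 0 (by rw [hs0, neg_zero, zero_smul])
  have hA' : IsGradedMatrix (fun _ : ι => 0) e A := by
    have := (isGradedMatrix_add_iff 0).mpr hA
    simpa using this
  have hsmem : s ∈ LinearMap.range A.mulVecLin := by
    apply hsat p' s hp'
    rw [← hs1, range_mulVecLin_eq_span]
    exact Submodule.subset_span ⟨1, rfl⟩
  -- There are no generators below degree `e 0`, so `s` has no components there. As column 0 is `-q'
  -- • s` and has degree `e 0`, the factor `q'` must be constant, and column 1 becomes a multiple of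
  -- column 0.
  have hlow : ∀ k < e 0, vcomp (fun _ : ι => 0) k s = 0 := by
    intro k hk
    obtain ⟨b, hb⟩ := hsmem
    rw [← hb, Matrix.mulVecLin_apply, hA'.vcomp_mulVec]
    have : vcomp e k b = 0 := funext fun i =>
      eq_zero_of_mem_piece (vcomp_mem_piece e k b) (hk.trans_le (he (Fin.zero_le i)))
    rw [this, Matrix.mulVec_zero]
  have hsne : s ≠ 0 := by
    rintro rfl
    exact hm.col_ne_zero 0 (by rw [hs0, smul_zero])
  obtain ⟨k, hk⟩ := Function.ne_iff.mp hsne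
  have hdeg : e 0 ≤ (s k).totalDegree := by
    obtain ⟨x, hx⟩ := ne_zero_iff.mp hk
    have h1 : x.degree ≤ (s k).totalDegree := by
      have := le_totalDegree (mem_support_iff.mpr hx)
      rwa [Finsupp.sum_fintype _ _ (fun _ => rfl), ← Finsupp.degree_eq_sum] at this
    refine le_trans ?_ h1
    by_contra! hlt
    have := congrArg (coeff x) (congrFun (hlow _ hlt) k)
    rw [vcomp_apply, coeff_hcomp, if_pos (by simp)] at this
    exact hx this
  have htot : (A.col 0 k).totalDegree ≤ e 0 := (hA k 0).totalDegree_le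
  rw [hs0, Pi.smul_apply, smul_eq_mul, totalDegree_mul_of_isDomain (neg_ne_zero.mpr hq') hk,
    totalDegree_neg] at htot
  have hq0 : q'.totalDegree = 0 := by omega
  rw [totalDegree_eq_zero_iff_eq_C] at hq0
  set a := coeff 0 q'
  have ha : a ≠ 0 := by
    intro h
    exact hq' (by rw [hq0, h, C_0])
  apply hm.col_notMem 1
  have : A.col 1 = (-(p' * C a⁻¹)) • A.col 0 := by
    rw [hs0, hs1, smul_smul]
    congr 1
    rw [neg_mul_neg, hq0, mul_assoc, ← C_mul, inv_mul_cancel₀ ha, C_1, mul_one]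
  rw [this]
  exact Submodule.smul_mem _ _ (Submodule.subset_span ⟨0, h01, rfl⟩)

/-- A homogeneous polynomial of positive degree whose partial derivatives vanish is zero. -/
lemma eq_zero_of_pderiv_eq_zero {f : S} {d : ℕ} (hd : d ≠ 0) (hf : f.IsHomogeneous d)
    (h : ∀ k, pderiv k f = 0) : f = 0 := by
  have := hf.sum_X_mul_pderiv
  simp only [h, mul_zero, Finset.sum_const_zero] at this
  simpa [hd] using this.symm

/-- The second exponent of a curve of degree `d` is at most `d - 1`. -/
lemma IsExponents.one_le {f : S} {d n : ℕ} {e : Fin (n + 2) → ℕ} (hd : d ≠ 0)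
    (hf : f.IsHomogeneous d) (hf0 : f ≠ 0) (h : IsExponents f e) : e 1 ≤ d - 1 := by
  by_contra! hlt
  obtain ⟨A, hA, hm, hr⟩ := h.exists_matrix 0
  simp only [zero_add] at hA
  -- All generators except the first have degree above `d - 1`. This is applied to the three Koszul
  -- syzygies of the partial derivatives.
  have hmul : ∀ s ∈ syzygies f, (∀ i, (s i).IsHomogeneous (d - 1)) → ∃ g : S, s = g • A.col 0 := by
    intro s hs hsd
    rw [← hr] at hs
    obtain ⟨b, hb, rfl⟩ := hA.exists_mem_piece (k := d - 1) (fun i => by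
      simpa using isHomogeneousInt_natCast.mpr (hsd i)) hs
    refine ⟨b 0, ?_⟩
    rw [mulVec_eq_sum_col, Finset.sum_eq_single 0 _ (by simp)]
    intro j _ hj
    rw [eq_zero_of_mem_piece hb, zero_smul]
    exact hlt.trans_le (h.1 (Fin.one_le_of_ne_zero hj))
  have hpd := fun k => hf.pderiv (i := k)
  have hz := isHomogeneous_zero (Fin 3) ℂ (d - 1)
  obtain ⟨g1, hg1⟩ := hmul ![0, pderiv 2 f, -pderiv 1 f]
    (by rw [syzygies, LinearMap.mem_ker, gradMap_apply, Fin.sum_univ_three]; simp; ring)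
    (by simpa [Fin.forall_fin_succ] using ⟨hz, hpd 2, (hpd 1).neg⟩)
  obtain ⟨g2, hg2⟩ := hmul ![-pderiv 2 f, 0, pderiv 0 f]
    (by rw [syzygies, LinearMap.mem_ker, gradMap_apply, Fin.sum_univ_three]; simp; ring)
    (by simpa [Fin.forall_fin_succ] using ⟨(hpd 2).neg, hz, hpd 0⟩)
  obtain ⟨g3, hg3⟩ := hmul ![pderiv 1 f, -pderiv 0 f, 0]
    (by rw [syzygies, LinearMap.mem_ker, gradMap_apply, Fin.sum_univ_three]; simp; ring)
    (by simpa [Fin.forall_fin_succ] using ⟨hpd 1, (hpd 0).neg, hz⟩)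
  have hv : A.col 0 ∈ syzygies f := by
    rw [← hr, range_mulVecLin_eq_span]
    exact Submodule.subset_span ⟨0, rfl⟩
  rw [syzygies, LinearMap.mem_ker, gradMap_apply, Fin.sum_univ_three] at hv
  apply hf0
  apply eq_zero_of_pderiv_eq_zero hd hf
  have hne := hm.col_ne_zero 0
  generalize A.col 0 = v at *
  simp only [funext_iff, Fin.forall_fin_succ, IsEmpty.forall_iff, and_true] at hg1 hg2 hg3 ⊢
  simp at hg1 hg2 hg3 ⊢
  -- The Koszul syzygy with zero entry at `k` is a multiple of `v`; as `v k ≠ 0`, the multiplier is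
  -- zero and two partial derivatives vanish. The relation `hv` then kills the third.
  obtain ⟨k, hk⟩ := Function.ne_iff.mp hne
  fin_cases k <;> simp at hk <;> grind

/-! ### Second syzygies form a free module -/

lemma X_dvd_of_dvd_mul {i j : Fin 3} (hij : i ≠ j) {p : S} (h : (X i : S) ∣ X j * p) :
    (X i : S) ∣ p := by
  refine ((X_prime (R := ℂ) (i := i)).dvd_or_dvd h).resolve_left fun h' => ?_
  have := (X_dvd_X (R := ℂ)).mp h'
  simp [hij] at this

lemma exists_eq_smul {ι : Type*} {p : S} {v : ι → S} (h : ∀ i, p ∣ v i) :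
    ∃ s : ι → S, v = p • s := by
  choose s hs using h
  exact ⟨s, funext hs⟩

lemma exists_of_constantCoeff_eq_zero {p : S} (h : constantCoeff p = 0) :
    ∃ a b c : S, p = X 0 * a + X 1 * b + X 2 * c := by
  have : p ∈ Ideal.span (X '' (Set.univ : Set (Fin 3)) : Set S) := by
    rw [mem_ideal_span_X_image]
    intro m hm
    by_contra! h0
    have : m = 0 := by
      ext i
      exact h0 i (Set.mem_univ i)
    subst this
    exact mem_support_iff.mp hm h
  have himg : (X '' (Set.univ : Set (Fin 3)) : Set S) = {X 0, X 1, X 2} := by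
    ext q
    simp [Fin.exists_fin_succ, eq_comm]
  rw [himg] at this
  obtain ⟨a, b, c, habc⟩ := Submodule.mem_span_triple.mp this
  exact ⟨a, b, c, by rw [← habc]; simp [mul_comm]⟩

/-- `X 2` is a nonzerodivisor modulo `(X 0, X 1)`: the ideal is monomial, and a factor `X 2` does
not affect divisibility by the other two variables. -/
lemma exists_of_X_two_mul_eq {p a b : S} (h : X 2 * p = X 0 * a + X 1 * b) :
    ∃ a' b' : S, p = X 0 * a' + X 1 * b' := by
  have himg : (X '' ({0, 1} : Set (Fin 3)) : Set S) = {X 0, X 1} := Set.image_pair _ _ _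
  have h1 : X 2 * p ∈ Ideal.span (X '' ({0, 1} : Set (Fin 3)) : Set S) := by
    rw [himg, Ideal.mem_span_pair]
    exact ⟨a, b, by rw [h]; ring⟩
  have h2 : p ∈ Ideal.span (X '' ({0, 1} : Set (Fin 3)) : Set S) := by
    rw [mem_ideal_span_X_image] at h1 ⊢
    intro m hm
    obtain ⟨i, hi, him⟩ := h1 (Finsupp.single 2 1 + m) (by
      rw [mem_support_iff, coeff_X_mul]
      exact mem_support_iff.mp hm)
    refine ⟨i, hi, ?_⟩
    have : (2 : Fin 3) ≠ i := by
      rintro rfl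
      simp at hi
    simpa [Finsupp.single_apply, this] using him
  rw [himg, Ideal.mem_span_pair] at h2
  obtain ⟨a', b', hab⟩ := h2
  exact ⟨a', b', by rw [← hab]; ring⟩

section
variable {κ ν : Type*} [Fintype κ] [Fintype ν] {f : S} {A : Matrix (Fin 3) κ S}

/-- The first half of the regularity of the variables on the kernel of `A`: `X 0` divides `k'`
coordinatewise, and the quotient stays in the kernel because `S` is a domain. -/
lemma exists_eq_X_smul {k k' : κ → S} (hk' : A.mulVec k' = 0)
    (h : (X 1 : S) • k' = (X 0 : S) • k) : ∃ w, A.mulVec w = 0 ∧ k' = (X 0 : S) • w := by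
  obtain ⟨w, rfl⟩ := exists_eq_smul (p := X 0) (v := k') fun i =>
    X_dvd_of_dvd_mul (j := 1) (by decide) ⟨k i, congrFun h i⟩
  refine ⟨w, ?_, rfl⟩
  rw [Matrix.mulVec_smul, smul_eq_zero] at hk'
  exact hk'.resolve_left (X_ne_zero _)

/-- `X 2` is a nonzerodivisor on the kernel of `A` modulo `(X 0, X 1)`. One first writes `k = X 0 •
a + X 1 • b` in the free module. The errors turn out to be `A a = -X 1 • s` and `A b = X 0 • s` with
a common `s`. This `s` is a syzygy of `f` by saturation, so `s = A w'`, and a Koszul correction by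
`w'` moves `a` and `b` into the kernel. -/
lemma exists_eq_X_smul_add_X_smul (hA : LinearMap.range A.mulVecLin = syzygies f)
    {k u v : κ → S} (hu : A.mulVec u = 0) (hv : A.mulVec v = 0)
    (h : (X 2 : S) • k = (X 0 : S) • u + (X 1 : S) • v) :
    ∃ u' v', A.mulVec u' = 0 ∧ A.mulVec v' = 0 ∧ k = (X 0 : S) • u' + (X 1 : S) • v' := by
  have hk : ∀ i, ∃ a b : S, k i = X 0 * a + X 1 * b := fun i =>
    exists_of_X_two_mul_eq (congrFun h i)
  choose a b hab using hk
  have hab' : k = (X 0 : S) • a + (X 1 : S) • b := funext hab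
  have h1 : (X 0 : S) • (u - (X 2 : S) • a) + (X 1 : S) • (v - (X 2 : S) • b) = 0 := by
    have : (X 0 : S) • u + (X 1 : S) • v - (X 2 : S) • ((X 0 : S) • a + (X 1 : S) • b) = 0 := by
      rw [← h, ← hab', sub_self]
    rw [← this]
    module
  obtain ⟨w, hw⟩ := exists_eq_smul (p := X 1) (v := u - (X 2 : S) • a) fun i =>
    X_dvd_of_dvd_mul (j := 0) (by decide) ⟨-(v - (X 2 : S) • b) i, by
      have := congrFun h1 i
      simp only [Pi.add_apply, Pi.smul_apply, smul_eq_mul, Pi.zero_apply] at this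
      rw [mul_neg]
      exact eq_neg_of_add_eq_zero_left this⟩
  have hw' : v - (X 2 : S) • b = -((X 0 : S) • w) := by
    rw [hw] at h1
    have : (X 1 : S) • (v - (X 2 : S) • b + (X 0 : S) • w) = 0 := by
      rw [← h1]
      module
    exact eq_neg_of_add_eq_zero_left ((smul_eq_zero.mp this).resolve_left (X_ne_zero _))
  have hAu : -((X 2 : S) • A.mulVec a) = (X 1 : S) • A.mulVec w := by
    rw [← Matrix.mulVec_smul A (X 1), ← hw, Matrix.mulVec_sub, hu, Matrix.mulVec_smul, zero_sub]
  have hAv : -((X 2 : S) • A.mulVec b) = -((X 0 : S) • A.mulVec w) := by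
    rw [← Matrix.mulVec_smul A (X 0), ← Matrix.mulVec_neg, ← hw', Matrix.mulVec_sub, hv,
      Matrix.mulVec_smul, zero_sub]
  obtain ⟨s, hs⟩ := exists_eq_smul (p := X 2) (v := A.mulVec w) fun i =>
    X_dvd_of_dvd_mul (j := 1) (by decide) ⟨-(A.mulVec a i), by
      have := congrFun hAu i
      simp only [Pi.neg_apply, Pi.smul_apply, smul_eq_mul] at this
      rw [← this, mul_neg]⟩
  have hAa : A.mulVec a = -((X 1 : S) • s) := by
    have : (X 2 : S) • (A.mulVec a + (X 1 : S) • s) = 0 := by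
      rw [smul_add, smul_comm (X 2 : S) (X 1 : S), ← hs, ← hAu]
      module
    exact eq_neg_of_add_eq_zero_left ((smul_eq_zero.mp this).resolve_left (X_ne_zero _))
  have hAb : A.mulVec b = (X 0 : S) • s := by
    have : (X 2 : S) • (A.mulVec b - (X 0 : S) • s) = 0 := by
      rw [smul_sub, smul_comm (X 2 : S) (X 0 : S), ← hs, ← neg_inj, neg_sub, sub_eq_add_neg, hAv]
      module
    exact sub_eq_zero.mp ((smul_eq_zero.mp this).resolve_left (X_ne_zero _))
  have hssyz : s ∈ LinearMap.range A.mulVecLin := by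
    rw [hA]
    apply mem_syzygies_of_smul (p := X 0) (X_ne_zero _)
    rw [← hA, ← hAb]
    exact ⟨b, rfl⟩
  obtain ⟨w', rfl⟩ := hssyz
  rw [Matrix.mulVecLin_apply] at *
  refine ⟨a + (X 1 : S) • w', b - (X 0 : S) • w', ?_, ?_, ?_⟩
  · rw [Matrix.mulVec_add, hAa, Matrix.mulVec_smul, neg_add_cancel]
  · rw [Matrix.mulVec_sub, hAb, Matrix.mulVec_smul, sub_self]
  · rw [hab']
    module

/-- Minimal generators of the module of second syzygies are linearly independent. -/
theorem IsMinimalMatrix.injective {B : Matrix κ ν S} (hB : IsMinimalMatrix B)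
    (hA : LinearMap.range A.mulVecLin = syzygies f)
    (hBA : LinearMap.range B.mulVecLin = LinearMap.ker A.mulVecLin) :
    Function.Injective B.mulVecLin := by
  have hmem : ∀ b, A.mulVec (B.mulVec b) = 0 := by
    intro b
    have : B.mulVecLin b ∈ LinearMap.ker A.mulVecLin := hBA ▸ LinearMap.mem_range_self _ b
    exact this
  have hex : ∀ k, A.mulVec k = 0 → ∃ b, B.mulVec b = k := by
    intro k hk
    have : k ∈ LinearMap.range B.mulVecLin := hBA ▸ LinearMap.mem_ker.mpr hk
    exact this
  -- By minimality a relation has coefficients in `(x, y, z)`. The variables form a regular sequence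
  -- on the second syzygies, so Koszul corrections turn its three parts into relations: the module
  -- `K` of relations satisfies `K = (x, y, z) K`.
  have step : ∀ a, B.mulVec a = 0 → ∃ a₀ a₁ a₂, B.mulVec a₀ = 0 ∧ B.mulVec a₁ = 0 ∧
      B.mulVec a₂ = 0 ∧ a = (X 0 : S) • a₀ + (X 1 : S) • a₁ + (X 2 : S) • a₂ := by
    intro a ha
    choose b c e hbce using fun j => exists_of_constantCoeff_eq_zero (hB a ha j)
    have habce : a = (X 0 : S) • b + (X 1 : S) • c + (X 2 : S) • e := funext hbce
    have h0 : (X 0 : S) • B.mulVec b + (X 1 : S) • B.mulVec c + (X 2 : S) • B.mulVec e = 0 := by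
      rw [← ha, habce]
      simp only [Matrix.mulVec_add, Matrix.mulVec_smul]
    obtain ⟨u, v, hu, hv, huv⟩ := exists_eq_X_smul_add_X_smul hA (k := B.mulVec e)
      (u := B.mulVec (-b)) (v := B.mulVec (-c)) (hmem _) (hmem _) (by
        rw [Matrix.mulVec_neg, Matrix.mulVec_neg, smul_neg, smul_neg]
        rw [eq_comm, ← sub_eq_zero, ← neg_eq_zero, ← h0]
        module)
    obtain ⟨b', rfl⟩ := hex u hu
    obtain ⟨c', rfl⟩ := hex v hv
    obtain ⟨w, hw, hcw⟩ := exists_eq_X_smul (A := A) (k' := B.mulVec (c + (X 2 : S) • c'))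
      (k := -B.mulVec (b + (X 2 : S) • b')) (hmem _) (by
        rw [huv] at h0
        simp only [Matrix.mulVec_add, Matrix.mulVec_smul]
        rw [← sub_eq_zero, ← h0]
        module)
    obtain ⟨b'', rfl⟩ := hex w hw
    have h1 : B.mulVec (e - (X 0 : S) • b' - (X 1 : S) • c') = 0 := by
      simp only [Matrix.mulVec_sub, Matrix.mulVec_smul, huv]
      module
    have h2 : B.mulVec (c + (X 2 : S) • c' - (X 0 : S) • b'') = 0 := by
      rw [Matrix.mulVec_sub, hcw, Matrix.mulVec_smul, sub_self]
    have h3 : a = (X 0 : S) • (b + (X 2 : S) • b' + (X 1 : S) • b'') +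
        (X 1 : S) • (c + (X 2 : S) • c' - (X 0 : S) • b'') +
        (X 2 : S) • (e - (X 0 : S) • b' - (X 1 : S) • c') := by
      rw [habce]
      module
    refine ⟨_, _, _, ?_, h2, h1, h3⟩
    have h4 := ha
    rw [h3, Matrix.mulVec_add, Matrix.mulVec_add, Matrix.mulVec_smul, Matrix.mulVec_smul,
      Matrix.mulVec_smul, h1, h2, smul_zero, smul_zero, add_zero, add_zero, smul_eq_zero] at h4
    exact h4.resolve_left (X_ne_zero _)
  -- Iterating `step`, every relation vanishes to arbitrary order at the origin.
  have hvan : ∀ n : ℕ, ∀ a, B.mulVec a = 0 → ∀ j (s : Fin 3 →₀ ℕ), s.degree < n →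
      coeff s (a j) = 0 := by
    intro n
    induction n with
    | zero => intro a _ j s hs; omega
    | succ n ih =>
      intro a ha j s hs
      obtain ⟨a₀, a₁, a₂, h₀, h₁, h₂, rfl⟩ := step a ha
      have key : ∀ (i : Fin 3) (b : ν → S), B.mulVec b = 0 → coeff s (X i * b j) = 0 := by
        intro i b hb
        rw [coeff_X_mul']
        split_ifs with hi
        · apply ih b hb
          have h1 : Finsupp.single i 1 + (s - Finsupp.single i 1) = s :=
            add_tsub_cancel_of_le (by
              rw [Finsupp.single_le_iff]
              exact Nat.one_le_iff_ne_zero.mpr (Finsupp.mem_support_iff.mp hi))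
          have h2 := congrArg Finsupp.degree h1
          rw [map_add, Finsupp.degree_single] at h2
          omega
        · rfl
      simp only [Pi.add_apply, Pi.smul_apply, smul_eq_mul, coeff_add, key 0 a₀ h₀, key 1 a₁ h₁,
        key 2 a₂ h₂, add_zero]
  rw [← LinearMap.ker_eq_bot, Submodule.eq_bot_iff]
  intro a ha
  funext j
  ext s
  exact hvan (s.degree + 1) a ha j s (Nat.lt_succ_self _)

end

/-! ### Existence of minimal homogeneous generators -/

/-- A homogeneous generating family with the fewest members is minimal, since a redundant member
could be dropped. The hypothesis `hN` says that `N` is graded. -/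
lemma exists_minimal_generators {ι : Type*} [Finite ι] (w : ι → ℕ) (N : Submodule S (ι → S))
    (hN : ∀ v ∈ N, ∀ k, vcomp w k v ∈ N) :
    ∃ (n : ℕ) (c : Fin n → ℕ) (B : Matrix ι (Fin n) S), Monotone c ∧ IsGradedMatrix w c B ∧
      IsMinimalMatrix B ∧ LinearMap.range B.mulVecLin = N := by
  classical
  have := Fintype.ofFinite ι
  let P : ℕ → Prop := fun n => ∃ (c : Fin n → ℕ) (B : Matrix ι (Fin n) S),
    IsGradedMatrix w c B ∧ LinearMap.range B.mulVecLin = N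
  have hP : ∃ n, P n := by
    let T : Set (ι → S) := {v | (∃ k, v ∈ piece w k) ∧ v ∈ N}
    have hT : Submodule.span S T = N := by
      apply le_antisymm
      · exact Submodule.span_le.mpr fun v hv => hv.2
      · intro v hv
        obtain ⟨n, hn⟩ := exists_eq_sum_vcomp w v
        rw [hn]
        exact Submodule.sum_mem _ fun k _ =>
          Submodule.subset_span ⟨⟨k, vcomp_mem_piece _ _ _⟩, hN v hv k⟩
    obtain ⟨t, htT, ht⟩ := (Submodule.fg_span_iff_fg_span_finset_subset T).mp
      (IsNoetherian.noetherian (Submodule.span S T))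
    have hdeg : ∀ j, ∃ k, (t.equivFin.symm j : ι → S) ∈ piece w k := fun j =>
      (htT (t.equivFin.symm j).2).1
    choose c hc using hdeg
    refine ⟨t.card, c, Matrix.of fun i j => (t.equivFin.symm j : ι → S) i, fun i j => hc j i, ?_⟩
    rw [range_mulVecLin_eq_span, ← hT, ht]
    congr 1
    ext v
    constructor
    · rintro ⟨j, rfl⟩
      exact (t.equivFin.symm j).2
    · intro hv
      refine ⟨t.equivFin ⟨v, hv⟩, ?_⟩
      funext i
      simp
  obtain ⟨c, B, hB, hBN⟩ := Nat.find_spec hP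
  have hmin : ∀ n, P n → Nat.find hP ≤ n := fun n hn => Nat.find_min' hP hn
  generalize Nat.find hP = n at *
  -- Sorting the columns by degree changes neither their span nor their number.
  have hB' : IsGradedMatrix w (c ∘ Tuple.sort c) (B.submatrix id (Tuple.sort c)) :=
    fun i j => hB i _
  have hBN' : LinearMap.range (B.submatrix id (Tuple.sort c)).mulVecLin = N := by
    rw [← hBN, range_mulVecLin_eq_span, range_mulVecLin_eq_span]
    congr 1
    exact (Tuple.sort c).surjective.range_comp B.col
  have hmono := Tuple.monotone_sort c
  generalize c ∘ Tuple.sort c = c' at *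
  generalize B.submatrix id (Tuple.sort c) = B' at *
  refine ⟨n, c', B', hmono, hB', hB'.isMinimalMatrix fun j hj => ?_, hBN'⟩
  obtain _ | n := n
  · exact j.elim0
  have hPn : P n := by
    refine ⟨c' ∘ j.succAbove, B'.submatrix id j.succAbove, fun i l => hB' i _, ?_⟩
    rw [← hBN', range_mulVecLin_eq_span, range_mulVecLin_eq_span]
    have himg : Set.range (B'.submatrix id j.succAbove).col = B'.col '' {j}ᶜ := by
      rw [← Fin.range_succAbove, ← Set.range_comp]
      rfl
    rw [himg]
    apply le_antisymm
    · exact Submodule.span_mono (Set.image_subset_range _ _)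
    · rw [Submodule.span_le]
      rintro _ ⟨l, rfl⟩
      by_cases hl : l = j
      · exact hl ▸ hj
      · exact Submodule.subset_span ⟨l, hl, rfl⟩
  have := hmin n hPn
  omega

/-! ### Hilbert functions -/

lemma hcomp_gradMap {f : S} {d : ℕ} (hf : f.IsHomogeneous d) (k : ℕ) (v : Fin 3 → S) :
    hcomp k (gradMap f v) = gradMap f (vcomp (fun _ => d - 1) k v) := by
  rw [gradMap_apply, gradMap_apply, map_sum]
  refine Finset.sum_congr rfl fun i _ => ?_
  rw [vcomp_apply, ← hcomp_mul (isHomogeneousInt_natCast.mpr (hf.pderiv (i := i)))]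
  congr 2
  ring

/-- The graded piece of degree `k` of the Jacobian ideal. -/
noncomputable def jacPiece (f : S) (k : ℕ) : Submodule ℂ S :=
  (LinearMap.range (gradMap f)).restrictScalars ℂ ⊓ homogeneousSubmodule (Fin 3) ℂ k

lemma mem_jacPiece {f : S} {k : ℕ} {p : S} :
    p ∈ jacPiece f k ↔ p ∈ LinearMap.range (gradMap f) ∧ p.IsHomogeneous k := Iff.rfl

lemma jacPiece_eq_map {f : S} {d : ℕ} (hf : f.IsHomogeneous d) (k : ℕ) :
    jacPiece f k =
      (piece (fun _ : Fin 3 => d - 1) k).map ((gradMap f).restrictScalars ℂ) := by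
  ext p
  rw [mem_jacPiece, ← isHomogeneousInt_natCast]
  constructor
  · rintro ⟨⟨v, rfl⟩, hp⟩
    refine ⟨vcomp (fun _ => d - 1) k v, vcomp_mem_piece _ _ _, ?_⟩
    rw [LinearMap.restrictScalars_apply, ← hcomp_gradMap hf, hp.hcomp_eq]
  · rintro ⟨v, hv, rfl⟩
    refine ⟨⟨v, rfl⟩, ?_⟩
    rw [LinearMap.restrictScalars_apply, ← vcomp_eq_self hv, ← hcomp_gradMap hf]
    exact isHomogeneousInt_hcomp _ _

lemma jacPiece_le (f : S) (k : ℕ) : jacPiece f k ≤ homogeneousSubmodule (Fin 3) ℂ k :=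
  inf_le_right

instance (f : S) (k : ℕ) : FiniteDimensional ℂ (jacPiece f k) :=
  Submodule.finiteDimensional_of_le (jacPiece_le f k)

lemma finrank_jacPiece_le (f : S) (k : ℕ) : Module.finrank ℂ (jacPiece f k) ≤ hf k 0 := by
  have := Submodule.finrank_mono (jacPiece_le f k)
  rwa [finrank_homogeneousSubmodule] at this

section
variable {ι κ : Type*} [Fintype κ]

lemma IsGradedMatrix.map_piece {w : ι → ℕ} {e : κ → ℕ} {A : Matrix ι κ S}
    (hA : IsGradedMatrix w e A) (k : ℕ) :
    (piece e k).map (A.mulVecLin.restrictScalars ℂ) =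
      piece w k ⊓ (LinearMap.range A.mulVecLin).restrictScalars ℂ := by
  ext v
  constructor
  · rintro ⟨b, hb, rfl⟩
    exact ⟨hA.mulVec_mem hb, ⟨b, rfl⟩⟩
  · rintro ⟨hv, hr⟩
    exact hA.exists_mem_piece hv hr

end

section
variable {m n D d : ℕ} {f : S} {a : Fin m → ℕ} {c : Fin n → ℕ} {A : Matrix (Fin 3) (Fin m) S}
  {B : Matrix (Fin m) (Fin n) S}

/-- The Hilbert function of the Jacobian ideal, computed from a graded free resolution. -/
theorem finrank_jacPiece_add (hf' : f.IsHomogeneous d)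
    (hA : IsGradedMatrix (fun _ => d - 1) a A) (hB : IsGradedMatrix a c B)
    (hinj : Function.Injective B.mulVecLin)
    (hBA : LinearMap.range B.mulVecLin = LinearMap.ker A.mulVecLin)
    (hAs : LinearMap.range A.mulVecLin = syzygies f) (k : ℕ) :
    Module.finrank ℂ (jacPiece f k) + ∑ i, hf k (a i) = 3 * hf k (d - 1) + ∑ j, hf k (c j) := by
  -- Rank–nullity at each of the three maps; exactness identifies every kernel with the preceding
  -- image, so the dimensions telescope.
  have h1 := finrank_map_add_finrank_inf_ker ((gradMap f).restrictScalars ℂ)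
    (piece (fun _ : Fin 3 => d - 1) k)
  have h2 := finrank_map_add_finrank_inf_ker (A.mulVecLin.restrictScalars ℂ) (piece a k)
  have h3 := finrank_map_add_finrank_inf_ker (B.mulVecLin.restrictScalars ℂ) (piece c k)
  rw [← jacPiece_eq_map hf', finrank_piece, LinearMap.ker_restrictScalars] at h1
  rw [hA.map_piece, finrank_piece, hAs, LinearMap.ker_restrictScalars] at h2
  rw [hB.map_piece, finrank_piece, hBA, LinearMap.ker_restrictScalars,
    LinearMap.ker_eq_bot.mpr hinj, Submodule.restrictScalars_bot, inf_bot_eq, finrank_bot] at h3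
  simp only [Finset.sum_const, Finset.card_univ, Fintype.card_fin, smul_eq_mul] at h1
  rw [← syzygies] at h1
  omega

end

/-! ### The Jacobian ideal of a reduced curve has codimension two -/

lemma totalDegree_pderiv_lt {i : Fin 3} {p : S} (h : pderiv i p ≠ 0) :
    (pderiv i p).totalDegree < p.totalDegree := by
  have key : ∀ s ∈ (pderiv i p).support, s.degree + 1 ≤ p.totalDegree := by
    intro s hs
    rw [mem_support_iff, coeff_pderiv] at hs
    have := le_totalDegree (mem_support_iff.mpr (left_ne_zero_of_mul hs))
    rwa [Finsupp.sum_fintype _ _ (fun _ => rfl), ← Finsupp.degree_eq_sum, map_add,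
      Finsupp.degree_single] at this
  obtain ⟨s, hs⟩ := support_nonempty.mpr h
  rw [totalDegree, Finset.sup_lt_iff (by have := key s hs; simp only [bot_eq_zero]; omega)]
  intro t ht
  have := key t ht
  rw [Finsupp.sum_fintype _ _ (fun _ => rfl), ← Finsupp.degree_eq_sum]
  omega

/-- In characteristic zero, a coefficient at an exponent with nonzero `i`-th entry survives in
`pderiv i p`. -/
lemma eq_C_of_pderiv_eq_zero {p : S} (h : ∀ i, pderiv i p = 0) : p = C (coeff 0 p) := by
  ext t
  rw [coeff_C]
  split_ifs with h0
  · rw [h0]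
  · obtain ⟨i, hi⟩ := Finsupp.ne_iff.mp (Ne.symm h0)
    have h1 := coeff_pderiv (i := i) p (t - Finsupp.single i 1)
    rw [h i, coeff_zero, tsub_add_cancel_of_le (by
      rw [Finsupp.single_le_iff]
      exact Nat.one_le_iff_ne_zero.mpr hi)] at h1
    exact (mul_eq_zero.mp h1.symm).resolve_right (Nat.cast_add_one_ne_zero _)

/-- By Euler's formula `g` divides `f`; write `f = g u`, where `g` does not divide `u` since `f` is
squarefree. The Leibniz rule makes `g` divide its own partial derivatives, which have smaller degree
and therefore vanish, so `g` is constant. -/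
lemma not_isUnit_dvd_pderiv {f : S} {d : ℕ} (hd : d ≠ 0) (hf : f.IsHomogeneous d)
    (hred : Squarefree f) {g : S} (hg : Irreducible g) (h : ∀ k, g ∣ pderiv k f) : False := by
  have hgf : g ∣ f := by
    have h1 : g ∣ (d : S) * f := by
      have := hf.sum_X_mul_pderiv
      rw [nsmul_eq_mul] at this
      rw [← this]
      exact Finset.dvd_sum fun i _ => (h i).mul_left _
    have h2 : f = C (d : ℂ)⁻¹ * ((d : S) * f) := by
      rw [← mul_assoc, ← map_natCast (C : ℂ →+* S), ← C_mul,
        inv_mul_cancel₀ (Nat.cast_ne_zero.mpr hd), C_1, one_mul]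
    rw [h2]
    exact h1.mul_left _
  obtain ⟨u, rfl⟩ := hgf
  have hu : ¬ g ∣ u := by
    rintro ⟨w, rfl⟩
    exact hg.not_isUnit (hred g ⟨w, by ring⟩)
  have hpd : ∀ k, pderiv k g = 0 := by
    intro k
    have h1 := h k
    rw [Derivation.leibniz, smul_eq_mul, smul_eq_mul] at h1
    have h2 : g ∣ u * pderiv k g := (dvd_add_right (dvd_mul_right _ _)).mp h1
    have h3 : g ∣ pderiv k g := (hg.prime.dvd_or_dvd h2).resolve_left hu
    by_contra h0
    have h4 := totalDegree_le_of_dvd_of_isDomain h3 h0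
    have h5 := totalDegree_pderiv_lt h0
    omega
  have hC := eq_C_of_pderiv_eq_zero hpd
  apply hg.not_isUnit
  rw [hC]
  refine (IsUnit.mk0 _ fun h0 => hg.ne_zero ?_).map C
  rw [hC, h0, C_0]

/-- Among the linear combinations of the partial derivatives of a reduced curve there are two
without common factor. -/
lemma exists_isRelPrime {f : S} {d : ℕ} (hd : d ≠ 0) (hf : f.IsHomogeneous d)
    (hred : Squarefree f) : ∃ g₁ g₂ : S, g₁ ∈ jacPiece f (d - 1) ∧ g₂ ∈ jacPiece f (d - 1) ∧
      g₁ ≠ 0 ∧ IsRelPrime g₁ g₂ := by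
  have hmem : ∀ k, pderiv k f ∈ jacPiece f (d - 1) := fun k =>
    ⟨⟨Pi.single k 1, by
      rw [gradMap_apply, Finset.sum_eq_single k (fun i _ hi => by simp [hi]) (by simp)]
      simp⟩, hf.pderiv⟩
  have main : ∀ i j k : Fin 3, (∀ l, l = i ∨ l = j ∨ l = k) → pderiv i f ≠ 0 →
      ∃ g₁ g₂ : S, g₁ ∈ jacPiece f (d - 1) ∧ g₂ ∈ jacPiece f (d - 1) ∧
      g₁ ≠ 0 ∧ IsRelPrime g₁ g₂ := by
    intro i j k hijk hi
    let F : Multiset S := UniqueFactorizationMonoid.factors (pderiv i f)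
    -- A factor dividing the combination for two values of `t` would divide all three partial
    -- derivatives. Each of the finitely many factors thus excludes at most one `t`.
    have hbad : ∀ g ∈ F, {t : ℂ | g ∣ pderiv j f + C t * pderiv k f}.Subsingleton := by
      intro g hg t ht u hu
      by_contra htu
      have hirr := UniqueFactorizationMonoid.irreducible_of_factor g hg
      have hgi : g ∣ pderiv i f := UniqueFactorizationMonoid.dvd_of_mem_factors hg
      have hk : g ∣ pderiv k f := by
        have h1 : g ∣ C (t - u) * pderiv k f := by
          have := dvd_sub (Set.mem_ofPred.mp ht) (Set.mem_ofPred.mp hu)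
          convert this using 1
          rw [C_sub]
          ring
        have h2 := h1.mul_left (C (t - u)⁻¹)
        rwa [← mul_assoc, ← C_mul, inv_mul_cancel₀ (sub_ne_zero.mpr htu), C_1, one_mul] at h2
      have hj : g ∣ pderiv j f := (dvd_add_left (hk.mul_left _)).mp (Set.mem_ofPred.mp ht)
      refine not_isUnit_dvd_pderiv hd hf hred hirr fun l => ?_
      rcases hijk l with rfl | rfl | rfl <;> assumption
    have hfin : (⋃ g ∈ {g | g ∈ F}, {t : ℂ | g ∣ pderiv j f + C t * pderiv k f}).Finite := by
      refine Set.Finite.biUnion ?_ fun g hg => (hbad g hg).finite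
      classical
      exact (Multiset.toFinset F).finite_toSet.subset fun g hg => by simpa using hg
    obtain ⟨t, ht⟩ := hfin.infinite_compl.nonempty
    refine ⟨pderiv i f, pderiv j f + C t * pderiv k f, hmem i, ?_, hi, ?_⟩
    · rw [← smul_eq_C_mul]
      exact Submodule.add_mem _ (hmem j) (Submodule.smul_mem _ _ (hmem k))
    · refine (UniqueFactorizationMonoid.isRelPrime_iff_no_prime_factors hi).mpr ?_
      intro p hpi hp hprime
      obtain ⟨q, hq, hpq⟩ :=
        UniqueFactorizationMonoid.exists_mem_factors_of_dvd hi hprime.irreducible hpi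
      exact ht (Set.mem_biUnion hq (Set.mem_ofPred.mpr (hpq.symm.dvd.trans hp)))
  have hex : ∃ i, pderiv i f ≠ 0 := by
    by_contra! h
    exact hred.ne_zero (eq_zero_of_pderiv_eq_zero hd hf h)
  obtain ⟨i, hi⟩ := hex
  fin_cases i
  · exact main 0 1 2 (by decide) hi
  · exact main 1 0 2 (by decide) hi
  · exact main 2 0 1 (by decide) hi

/-- The ideal contains `g₁ S + g₂ S` with `g₁`, `g₂` coprime, whose only relations are the multiples
of `(-g₂, g₁)`. For large `k` this bounds `dim M(f)_k` by `(d - 1)²`. -/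
lemma two_mul_hf_le {f : S} {d : ℕ} (hd : d ≠ 0) (hf' : f.IsHomogeneous d)
    (hred : Squarefree f) (k : ℕ) :
    2 * hf k (d - 1) ≤ Module.finrank ℂ (jacPiece f k) + hf k (2 * (d - 1)) := by
  obtain ⟨g₁, g₂, ⟨hg₁, hd₁⟩, ⟨hg₂, hd₂⟩, hne, hrel⟩ := exists_isRelPrime hd hf' hred
  replace hd₁ := isHomogeneousInt_natCast.mpr hd₁
  replace hd₂ := isHomogeneousInt_natCast.mpr hd₂
  set D := d - 1
  let g : (Fin 2 → S) →ₗ[ℂ] S :=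
    LinearMap.mulRight ℂ g₁ ∘ₗ LinearMap.proj 0 + LinearMap.mulRight ℂ g₂ ∘ₗ LinearMap.proj 1
  have hg : ∀ v, g v = v 0 * g₁ + v 1 * g₂ := fun v => rfl
  let s : S →ₗ[ℂ] (Fin 2 → S) :=
    LinearMap.pi ![-LinearMap.mulRight ℂ g₂, LinearMap.mulRight ℂ g₁]
  have hs0 : ∀ w, s w 0 = -(w * g₂) := fun w => rfl
  have hs1 : ∀ w, s w 1 = w * g₁ := fun w => rfl
  have h1 := finrank_map_add_finrank_inf_ker g (piece (fun _ : Fin 2 => D) k)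
  rw [finrank_piece] at h1
  simp only [Finset.sum_const, Finset.card_univ, Fintype.card_fin, smul_eq_mul] at h1
  have h2 : (piece (fun _ : Fin 2 => D) k).map g ≤ jacPiece f k := by
    rintro _ ⟨v, hv, rfl⟩
    refine ⟨?_, ?_⟩
    · rw [hg]
      exact Submodule.add_mem (LinearMap.range (gradMap f)) (Submodule.smul_mem _ _ hg₁)
        (Submodule.smul_mem _ _ hg₂)
    · rw [← homogeneousInt_natCast]
      have := (((hv 0).mul hd₁).add ((hv 1).mul hd₂))
      rwa [sub_add_cancel] at this
  have h3 : piece (fun _ : Fin 2 => D) k ⊓ LinearMap.ker g ≤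
      (homogeneousInt ((k : ℤ) - (2 * D : ℕ))).map s := by
    rintro v ⟨hv, hvg⟩
    rw [SetLike.mem_coe, LinearMap.mem_ker, hg] at hvg
    have hdvd : g₁ ∣ v 1 := hrel.dvd_of_dvd_mul_right (z := g₂)
      ⟨-v 0, by linear_combination hvg⟩
    obtain ⟨w, hw⟩ := hdvd
    have hv0 : v 0 = -(w * g₂) := by
      have : g₁ * (v 0 + w * g₂) = 0 := by linear_combination hvg - g₂ * hw
      exact eq_neg_of_add_eq_zero_left ((mul_eq_zero.mp this).resolve_left hne)
    have hdeg : (k : ℤ) - (2 * D : ℕ) + D = k - D := by push_cast; ring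
    refine ⟨hcomp ((k : ℤ) - (2 * D : ℕ)) w, isHomogeneousInt_hcomp _ _, ?_⟩
    funext i
    fin_cases i
    · change s _ 0 = v 0
      rw [hs0, ← hcomp_mul hd₂, hdeg, ← map_neg, ← hv0]
      exact (hv 0).hcomp_eq
    · change s _ 1 = v 1
      rw [hs1, ← hcomp_mul hd₁, hdeg, mul_comm w, ← hw]
      exact (hv 1).hcomp_eq
  have h4 := Submodule.finrank_mono h2
  have h5 := (Submodule.finrank_mono h3).trans (Submodule.finrank_map_le _ _)
  rw [finrank_homogeneousInt] at h5
  omega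

/-! ### Numerical consequences of the resolution -/

lemma coeffs_eq_zero_of_bounded {α β γ M : ℤ} {k₀ : ℕ}
    (h : ∀ k : ℕ, k₀ ≤ k → |α * (k + 1) * (k + 2) + β * (2 * k + 3) + γ| ≤ M) :
    α = 0 ∧ β = 0 := by
  have hM : 0 ≤ M := (abs_nonneg _).trans (h k₀ le_rfl)
  obtain ⟨N, rfl⟩ := Int.eq_ofNat_of_zero_le hM
  have h0 := abs_le.mp (h k₀ le_rfl)
  -- With step `h = 4N + 1` the second difference is `2αh²` and is at most `4N` in absolute value,
  -- which forces `α = 0`. The first difference `2βh` then forces `β = 0`.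
  have h1 := abs_le.mp (h (k₀ + (4 * N + 1)) (by omega))
  have h2 := abs_le.mp (h (k₀ + 2 * (4 * N + 1)) (by omega))
  push_cast at h0 h1 h2
  have hα : α = 0 := by
    by_contra hne
    rcases lt_or_gt_of_ne hne with hlt | hgt
    · have : α ≤ -1 := by omega
      nlinarith [mul_le_mul_of_nonneg_right this (sq_nonneg (4 * (N : ℤ) + 1))]
    · have : 1 ≤ α := by omega
      nlinarith [mul_le_mul_of_nonneg_right this (sq_nonneg (4 * (N : ℤ) + 1))]
  subst hα
  refine ⟨rfl, ?_⟩
  by_contra hne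
  rcases lt_or_gt_of_ne hne with hlt | hgt
  · have : β ≤ -1 := by omega
    nlinarith [mul_le_mul_of_nonneg_right this (by positivity : 0 ≤ 4 * (N : ℤ) + 1)]
  · have : 1 ≤ β := by omega
    nlinarith [mul_le_mul_of_nonneg_right this (by positivity : 0 ≤ 4 * (N : ℤ) + 1)]

lemma two_mul_hf' {k a : ℕ} (h : a ≤ k) :
    2 * (hf k a : ℤ) = ((k : ℤ) + 1) * (k + 2) - a * (2 * k + 3) + (a : ℤ) ^ 2 := by
  rw [two_mul_hf h]
  ring

lemma two_mul_sum_hf {n : ℕ} {a : Fin n → ℕ} {k : ℕ} (h : ∀ i, a i ≤ k) :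
    2 * (∑ i, (hf k (a i) : ℤ)) =
      n * (((k : ℤ) + 1) * (k + 2)) - (∑ i, (a i : ℤ)) * (2 * k + 3) + ∑ i, (a i : ℤ) ^ 2 := by
  rw [Finset.mul_sum, Finset.sum_congr rfl fun i _ => two_mul_hf' (h i), Finset.sum_add_distrib,
    Finset.sum_sub_distrib, Finset.sum_mul, Finset.sum_const, Finset.card_univ, Fintype.card_fin,
    nsmul_eq_mul]

/-- The numerical invariants of a graded free resolution of the Jacobian algebra of a reduced
curve: the ranks, the sum of the shifts, and the Hilbert function in large degrees. -/
theorem resolution_numerics {m n d : ℕ} {f : S} {a : Fin m → ℕ} {c : Fin n → ℕ}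
    {A : Matrix (Fin 3) (Fin m) S} {B : Matrix (Fin m) (Fin n) S} (hd : d ≠ 0)
    (hf' : f.IsHomogeneous d) (hred : Squarefree f)
    (hA : IsGradedMatrix (fun _ => d - 1) a A) (hB : IsGradedMatrix a c B)
    (hinj : Function.Injective B.mulVecLin)
    (hBA : LinearMap.range B.mulVecLin = LinearMap.ker A.mulVecLin)
    (hAs : LinearMap.range A.mulVecLin = syzygies f) :
    m = n + 2 ∧ ∑ j, (c j : ℤ) = ∑ i, (a i : ℤ) - 3 * (d - 1 : ℕ) ∧
    ∃ k₀, ∀ k, k₀ ≤ k → 2 * ((hf k 0 : ℤ) - Module.finrank ℂ (jacPiece f k)) =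
      ∑ i, (a i : ℤ) ^ 2 - 3 * ((d - 1 : ℕ) : ℤ) ^ 2 - ∑ j, (c j : ℤ) ^ 2 := by
  set D := d - 1
  -- Beyond every shift, so that each `hf k a` is given by its polynomial.
  let k₀ := 2 * D + ∑ i, a i + ∑ j, c j
  have hk₀ : ∀ k, k₀ ≤ k → D ≤ k ∧ 2 * D ≤ k ∧ (∀ i, a i ≤ k) ∧ ∀ j, c j ≤ k := by
    intro k hk
    refine ⟨by omega, by omega, fun i => ?_, fun j => ?_⟩
    · have := Finset.single_le_sum (f := a) (fun _ _ => Nat.zero_le _) (Finset.mem_univ i)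
      omega
    · have := Finset.single_le_sum (f := c) (fun _ _ => Nat.zero_le _) (Finset.mem_univ j)
      omega
  set α : ℤ := (m : ℤ) - n - 2 with hα
  set β : ℤ := 3 * D - ∑ i, (a i : ℤ) + ∑ j, (c j : ℤ) with hβ
  set γ : ℤ := ∑ i, (a i : ℤ) ^ 2 - 3 * (D : ℤ) ^ 2 - ∑ j, (c j : ℤ) ^ 2 with hγ
  have hform : ∀ k, k₀ ≤ k → 2 * ((hf k 0 : ℤ) - Module.finrank ℂ (jacPiece f k)) =
      α * (k + 1) * (k + 2) + β * (2 * k + 3) + γ := by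
    intro k hk
    obtain ⟨h1, h2, h3, h4⟩ := hk₀ k hk
    have h5 := finrank_jacPiece_add hf' hA hB hinj hBA hAs k
    zify at h5
    have h6 := two_mul_sum_hf h3
    have h7 := two_mul_sum_hf h4
    have h8 := two_mul_hf' h1
    have h9 := two_mul_hf' (Nat.zero_le k)
    rw [hα, hβ, hγ]
    push_cast at *
    linear_combination h9 - 2 * h5 + h6 - h7 - 3 * h8
  have hbound : ∀ k : ℕ, k₀ ≤ k → |α * (k + 1) * (k + 2) + β * (2 * k + 3) + γ| ≤
      2 * (D : ℤ) ^ 2 := by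
    intro k hk
    obtain ⟨h1, h2, -, -⟩ := hk₀ k hk
    rw [← hform k hk, abs_le]
    have h3 := finrank_jacPiece_le f k
    have h4 := two_mul_hf_le hd hf' hred k
    have h5 := two_mul_hf' h1
    have h6 := two_mul_hf' h2
    have h7 := two_mul_hf' (Nat.zero_le k)
    zify at h3 h4
    push_cast at *
    constructor
    · nlinarith [sq_nonneg (D : ℤ)]
    · linarith
  obtain ⟨h1, h2⟩ := coeffs_eq_zero_of_bounded hbound
  refine ⟨by omega, by linarith, k₀, fun k hk => ?_⟩
  rw [hform k hk, h1, h2]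
  ring

/-! ### Degrees of the second syzygies -/

lemma hf_of_lt {k a : ℕ} (h : k < a) : hf k a = 0 := if_neg (by omega)

lemma hf_self (k : ℕ) : hf k k = 1 := by
  simp [hf]

lemma sum_hf_eq {n : ℕ} (c : Fin n → ℕ) (k : ℕ) :
    ∑ j, hf k (c j) = ∑ v ∈ Finset.range (k + 1), Fintype.card {j // c j = v} * hf k v := by
  have h1 : ∑ j, hf k (c j) = ∑ j with c j ∈ Finset.range (k + 1), hf k (c j) := by
    rw [Finset.sum_filter_of_ne]
    intro j _ hj
    rw [Finset.mem_range]
    by_contra h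
    exact hj (hf_of_lt (by omega))
  rw [h1, ← Finset.sum_fiberwise_eq_sum_filter]
  refine Finset.sum_congr rfl fun v _ => ?_
  rw [Finset.sum_congr rfl (g := fun _ => hf k v) (fun j hj => by rw [(Finset.mem_filter.mp hj).2]),
    Finset.sum_const, smul_eq_mul, Fintype.card_subtype]

/-- Since `hf k k = 1` and `hf k v = 0` for `v > k`, the number of shifts of each value is found
recursively from the sums. -/
lemma monotone_eq_of_sum_hf_eq {n : ℕ} {c c' : Fin n → ℕ} (hc : Monotone c) (hc' : Monotone c')
    (h : ∀ k, ∑ j, hf k (c j) = ∑ j, hf k (c' j)) : c = c' := by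
  have key : ∀ k, Fintype.card {j // c j = k} = Fintype.card {j // c' j = k} := by
    intro k
    induction k using Nat.strong_induction_on with
    | _ k ih =>
      have hk := h k
      rw [sum_hf_eq, sum_hf_eq, Finset.sum_range_succ, Finset.sum_range_succ, hf_self, mul_one,
        mul_one, Finset.sum_congr rfl fun v hv => by rw [ih v (Finset.mem_range.mp hv)]] at hk
      exact Nat.add_left_cancel hk
  have hle : ∀ (c : Fin n → ℕ) (k : ℕ), Fintype.card {j // c j ≤ k} =
      ∑ v ∈ Finset.range (k + 1), Fintype.card {j // c j = v} := by
    intro c k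
    rw [Fintype.card_subtype, Finset.card_eq_sum_card_fiberwise (f := c)
      (t := Finset.range (k + 1)) (fun j hj => by
        simp only [Finset.coe_filter, Finset.mem_univ, true_and, Set.mem_ofPred_eq] at hj
        simp only [Finset.coe_range, Set.mem_Iio]
        omega)]
    refine Finset.sum_congr rfl fun v hv => ?_
    rw [Fintype.card_subtype, Finset.filter_filter]
    congr 1
    ext j
    simp only [Finset.mem_filter, Finset.mem_univ, true_and, Finset.mem_range] at hv ⊢
    omega
  refine monotone_eq_of_card_le_eq hc hc' fun k => ?_
  rw [hle, hle, Finset.sum_congr rfl fun v _ => key v]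

/-- The degrees of the second syzygies exceed those of the first syzygies, shifted by two. -/
theorem lt_degree_second_syzygy {n D : ℕ} {f : S} {e : Fin (n + 2) → ℕ} {c : Fin n → ℕ}
    {A : Matrix (Fin 3) (Fin (n + 2)) S} {B : Matrix (Fin (n + 2)) (Fin n) S}
    (he : Monotone e) (hc : Monotone c) (hA : ∀ i j, (A i j).IsHomogeneous (e j))
    (hm : IsMinimalMatrix A) (hB : IsGradedMatrix (fun i => D + e i) c B)
    (hinj : Function.Injective B.mulVecLin)
    (hBA : LinearMap.range B.mulVecLin = LinearMap.ker A.mulVecLin)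
    (hAs : LinearMap.range A.mulVecLin = syzygies f) (j : Fin n) :
    D + e j.succ.succ < c j := by
  by_contra! hle
  have hmem : ∀ b, A.mulVec (B.mulVec b) = 0 := by
    intro b
    have : B.mulVecLin b ∈ LinearMap.ker A.mulVecLin := hBA ▸ LinearMap.mem_range_self _ b
    exact this
  -- In this block the entries have degree at most 0: those of negative degree vanish, and the
  -- scalars vanish by minimality of `A`.
  have hzero : ∀ (i : Fin (n + 2)) (l : Fin n), j.succ.succ ≤ i → l ≤ j → B i l = 0 := by
    intro i l hi hl
    have h1 := he hi
    have h2 := hc hl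
    rcases lt_or_ge (c l) (D + e i) with h | h
    · exact (hB i l).eq_zero_of_neg (by push_cast; omega)
    · have h3 : (c l : ℤ) - ((D + e i : ℕ) : ℤ) = 0 := by omega
      have h4 := hB i l
      rw [h3] at h4
      rw [h4.eq_C, ← C_0]
      congr 1
      have := hm (B.mulVec (Pi.single l 1)) (hmem _) i
      rwa [Matrix.mulVec_single_one] at this
  -- Outside rows 0 and 1, the first `j + 1` columns are supported on only `j` rows. Some nonzero
  -- combination `b` of them is therefore supported on rows 0 and 1.
  let row : Fin j → Fin (n + 2) := fun i => ⟨i + 2, by omega⟩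
  let φ : ({l // l ≤ j} → S) →ₗ[S] (Fin j → S) := (B.submatrix row Subtype.val).mulVecLin
  have hφ : ¬ Function.Injective φ := by
    intro h
    have := card_le_of_injective S φ h
    rw [Fintype.card_subtype, Finset.filter_ge_eq_Iic, Fin.card_Iic, Fintype.card_fin] at this
    omega
  rw [← LinearMap.ker_eq_bot, Submodule.eq_bot_iff] at hφ
  push Not at hφ
  obtain ⟨u, hu, hu0⟩ := hφ
  let b : Fin n → S := fun l => if h : l ≤ j then u ⟨l, h⟩ else 0
  have hb0 : ∀ l, ¬ l ≤ j → b l = 0 := fun l hl => by simp [b, hl]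
  have hbu : b ∘ Subtype.val = u := by
    funext i
    simp [b, i.2]
  have hrow : ∀ i, B.mulVec b (row i) = 0 := by
    intro i
    have h1 := congrFun (submatrix_mulVec_comp (B.submatrix row id) (fun l => l ≤ j) hb0) i
    rw [hbu] at h1
    exact h1.symm.trans (congrFun (LinearMap.mem_ker.mp hu) i)
  have hrest : ∀ i : Fin (n + 2), i ≠ 0 → i ≠ 1 → B.mulVec b i = 0 := by
    intro i h0 h1
    have h2 : 2 ≤ (i : ℕ) := by
      have h3 := Fin.val_ne_of_ne h0
      have h4 := Fin.val_ne_of_ne h1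
      rw [Fin.val_zero] at h3
      rw [Fin.val_one] at h4
      omega
    by_cases hi : (i : ℕ) < j + 2
    · have := hrow ⟨i - 2, by omega⟩
      convert this using 2
      apply Fin.ext
      simp only [row]
      omega
    · change ∑ l, B i l * b l = 0
      refine Finset.sum_eq_zero fun l _ => ?_
      by_cases hl : l ≤ j
      · rw [hzero i l (by rw [Fin.le_def, Fin.val_succ, Fin.val_succ]; omega) hl, zero_mul]
      · rw [hb0 l hl, mul_zero]
  -- Applying `A` gives a relation between the two lowest generators. Their independence forces `B b
  -- = 0`, which contradicts injectivity of `B`.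
  have hpq : B.mulVec b 0 • A.col 0 + B.mulVec b 1 • A.col 1 = 0 := by
    rw [← hmem b, mulVec_eq_sum_col A]
    symm
    exact Fintype.sum_eq_add 0 1 (by simp) fun i hi => by rw [hrest i hi.1 hi.2, zero_smul]
  obtain ⟨h0, h1⟩ := hm.independent hA he (fun p s hp hs => by
    rw [hAs] at hs ⊢
    exact mem_syzygies_of_smul hp hs) hpq
  have hBb : B.mulVecLin b = B.mulVecLin 0 := by
    rw [map_zero]
    funext i
    by_cases hi0 : i = 0
    · rw [hi0]; exact h0
    by_cases hi1 : i = 1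
    · rw [hi1]; exact h1
    exact hrest i hi0 hi1
  apply hu0
  rw [← hbu, hinj hBb]
  rfl

/-! ### Affine charts -/

/-- Dehomogenization in the chart `x_i = 1`, centered at `[v]`. -/
noncomputable def dehom (v : Fin 3 → ℂ) (i : Fin 3) : S →ₐ[ℂ] MvPolynomial (Fin 2) ℂ :=
  aeval (i.insertNth (1 : MvPolynomial (Fin 2) ℂ)
    (fun j : Fin 2 => X j + C (v (i.succAbove j) / v i)))

lemma dehom_X_self (v : Fin 3 → ℂ) (i : Fin 3) : dehom v i (X i) = 1 := by
  simp [dehom]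

lemma dehom_X_succAbove (v : Fin 3 → ℂ) (i : Fin 3) (j : Fin 2) :
    dehom v i (X (i.succAbove j)) = X j + C (v (i.succAbove j) / v i) := by
  simp [dehom]

lemma dehom_C (v : Fin 3 → ℂ) (i : Fin 3) (a : ℂ) : dehom v i (C a) = C a :=
  (dehom v i).commutes a

lemma exists_dehom_eq (v : Fin 3 → ℂ) (i : Fin 3) {k : ℕ} {h : MvPolynomial (Fin 2) ℂ}
    (hk : h.totalDegree ≤ k) : ∃ H : S, H.IsHomogeneous k ∧ dehom v i H = h := by
  -- `L j` dehomogenizes to the local coordinate `X j` and `X i` to 1, so powers of `X i` pad every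
  -- monomial up to degree `k`.
  let L : Fin 2 → S := fun j => X (i.succAbove j) - C (v (i.succAbove j) / v i) * X i
  have hL : ∀ j, (L j).IsHomogeneous 1 := fun j =>
    (isHomogeneous_X _ _).sub (isHomogeneous_C_mul_X _ _)
  have hdL : ∀ j, dehom v i (L j) = X j := by
    intro j
    rw [map_sub, map_mul, dehom_X_self, dehom_X_succAbove, mul_one, dehom_C,
      add_sub_cancel_right]
  refine ⟨∑ s ∈ h.support, C (coeff s h) * (X i ^ (k - s.degree) * ∏ j, L j ^ s j), ?_, ?_⟩
  · refine IsHomogeneous.sum _ _ _ fun s hs => IsHomogeneous.C_mul ?_ _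
    have h1 : s.degree ≤ k := by
      have := (le_totalDegree hs).trans hk
      rwa [Finsupp.sum_fintype _ _ (fun _ => rfl), ← Finsupp.degree_eq_sum] at this
    have h2 := (isHomogeneous_X_pow (R := ℂ) i (k - s.degree)).mul
      (IsHomogeneous.prod Finset.univ (fun j => L j ^ s j) (fun j => 1 * s j)
        fun j _ => (hL j).pow (s j))
    convert h2 using 1
    simp only [one_mul]
    rw [← Finsupp.degree_eq_sum]
    omega
  · rw [map_sum]
    conv_rhs => rw [h.as_sum]
    refine Finset.sum_congr rfl fun s _ => ?_
    rw [map_mul, map_mul, map_pow, dehom_X_self, one_pow, one_mul, map_prod, monomial_eq, dehom_C,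
      Finsupp.prod_fintype _ _ (fun _ => pow_zero _)]
    simp only [map_pow, hdL]

lemma eval_smul_of_isHomogeneous {p : S} {k : ℕ} (hp : p.IsHomogeneous k) (a : ℂ)
    (v : Fin 3 → ℂ) : eval (a • v) p = a ^ k * eval v p := by
  rw [eval_eq', eval_eq', Finset.mul_sum]
  refine Finset.sum_congr rfl fun s hs => ?_
  have hdeg : ∑ i, s i = k := by
    rw [← Finsupp.degree_eq_sum]
    by_contra h
    exact mem_support_iff.mp hs (hp.coeff_eq_zero h)
  simp only [Pi.smul_apply, smul_eq_mul, mul_pow, Finset.prod_mul_distrib,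
    Finset.prod_pow_eq_pow_sum, hdeg]
  ring

lemma eval_dehom (v : Fin 3 → ℂ) (i : Fin 3) (p : S) (u : Fin 2 → ℂ) :
    eval u (dehom v i p) =
      eval (i.insertNth (1 : ℂ) fun j => u j + v (i.succAbove j) / v i) p := by
  induction p using MvPolynomial.induction_on with
  | C a => rw [dehom_C, eval_C, eval_C]
  | add p q hp hq => rw [map_add, map_add, map_add, hp, hq]
  | mul_X p k hp =>
    rw [map_mul, map_mul, map_mul, hp, eval_X]
    congr 1
    rcases Fin.eq_self_or_eq_succAbove i k with rfl | ⟨j, rfl⟩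
    · simp [dehom_X_self]
    · simp [dehom_X_succAbove]

lemma constantCoeff_dehom {v : Fin 3 → ℂ} {i : Fin 3} (hv : v i ≠ 0) (p : S) :
    constantCoeff (dehom v i p) = eval ((v i)⁻¹ • v) p := by
  rw [← eval_zero, eval_dehom]
  congr 2
  funext k
  rcases Fin.eq_self_or_eq_succAbove i k with rfl | ⟨j, rfl⟩
  · simp [hv]
  · simp [div_eq_inv_mul]

lemma constantCoeff_dehom_eq_zero_iff {v : Fin 3 → ℂ} {i : Fin 3} (hv : v i ≠ 0) {p : S} {k : ℕ}
    (hp : p.IsHomogeneous k) : constantCoeff (dehom v i p) = 0 ↔ eval v p = 0 := by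
  rw [constantCoeff_dehom hv, eval_smul_of_isHomogeneous hp]
  simp [hv]

lemma eq_zero_of_dehom_eq_zero {v : Fin 3 → ℂ} {i : Fin 3} {p : S} {k : ℕ}
    (hp : p.IsHomogeneous k) (h : dehom v i p = 0) : p = 0 := by
  -- The factor `X i` restricts the check to points of the chart.
  have hX : X i * p = 0 := by
    apply MvPolynomial.funext
    intro w
    rw [map_mul, eval_X, map_zero]
    by_cases hw : w i = 0
    · rw [hw, zero_mul]
    have h1 := eval_dehom v i p fun j => w (i.succAbove j) / w i - v (i.succAbove j) / v i
    rw [h, map_zero] at h1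
    have h2 : (i.insertNth (1 : ℂ) fun j => w (i.succAbove j) / w i - v (i.succAbove j) / v i +
        v (i.succAbove j) / v i : Fin 3 → ℂ) = (w i)⁻¹ • w := by
      funext k
      rcases Fin.eq_self_or_eq_succAbove i k with rfl | ⟨j, rfl⟩
      · simp [hw]
      · simp [div_eq_inv_mul]
    rw [h2, eval_smul_of_isHomogeneous hp] at h1
    rw [(mul_eq_zero.mp h1.symm).resolve_left (pow_ne_zero _ (inv_ne_zero hw)), mul_zero]
  exact (mul_eq_zero.mp hX).resolve_left (X_ne_zero _)

instance : originIdeal.IsMaximal :=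
  RingHom.ker_isMaximal_of_surjective _ fun a => ⟨C a, constantCoeff_C _ a⟩

lemma mem_originIdeal {h : MvPolynomial (Fin 2) ℂ} : h ∈ originIdeal ↔ constantCoeff h = 0 :=
  RingHom.mem_ker

lemma originIdeal_eq : originIdeal = idealOfVars (Fin 2) ℂ := by
  ext p
  rw [mem_originIdeal, ← pow_one (idealOfVars (Fin 2) ℂ), mem_pow_idealOfVars_iff']
  constructor
  · intro h x hx
    rw [(Finsupp.degree_eq_zero_iff x).mp (by omega)]
    exact h
  · intro h
    exact h 0 (by simp)

open IsLocalRing in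
/-- Modulo a power of the maximal ideal every germ is a polynomial of bounded degree. -/
lemma exists_algebraMap_sub_mem (N : ℕ) (t : LocalRing) :
    ∃ h : MvPolynomial (Fin 2) ℂ, h.totalDegree ≤ N ∧
      algebraMap _ LocalRing h - t ∈ maximalIdeal LocalRing ^ N := by
  obtain ⟨h, hh⟩ :=
    (IsLocalization.AtPrime.equivQuotMaximalIdealPow originIdeal LocalRing N).surjective
      (Ideal.Quotient.mk _ t)
  obtain ⟨h, rfl⟩ := Ideal.Quotient.mk_surjective h
  rw [IsLocalization.AtPrime.equivQuotMaximalIdealPow_apply_mk, Ideal.Quotient.eq] at hh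
  let g := ∑ k ∈ Finset.range N, homogeneousComponent k h
  refine ⟨g, ?_, ?_⟩
  · refine (totalDegree_finsetSum _ _).trans (Finset.sup_le fun k hk => ?_)
    exact (homogeneousComponent_isHomogeneous k h).totalDegree_le.trans
      (Finset.mem_range.mp hk).le
  · have hg : g - h ∈ originIdeal ^ N := by
      rw [originIdeal_eq, mem_pow_idealOfVars_iff']
      intro x hx
      rw [coeff_sub, coeff_sum]
      simp only [coeff_homogeneousComponent]
      simp [hx]
    have h1 : algebraMap _ LocalRing (g - h) ∈ maximalIdeal LocalRing ^ N := by
      rw [← Localization.AtPrime.map_eq_maximalIdeal, ← Ideal.map_pow]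
      exact Ideal.mem_map_of_mem _ hg
    have := Ideal.add_mem _ h1 hh
    rwa [map_sub, sub_add_sub_cancel] at this

section
open IsLocalRing

/-! ### Germs of polynomials at points of the projective plane -/

/-- The index of the affine chart used at a point of the projective plane. -/
noncomputable def chart (p : Projectivization ℂ (Fin 3 → ℂ)) : Fin 3 :=
  (exists_rep_ne_zero p).choose

lemma rep_chart_ne_zero (p : Projectivization ℂ (Fin 3 → ℂ)) : p.rep (chart p) ≠ 0 :=
  (exists_rep_ne_zero p).choose_spec

/-- The germ at `p` of the dehomogenization of a polynomial. -/
noncomputable def toLocal (p : Projectivization ℂ (Fin 3 → ℂ)) : S →ₐ[ℂ] LocalRing :=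
  (IsScalarTower.toAlgHom ℂ (MvPolynomial (Fin 2) ℂ) LocalRing).comp (dehom p.rep (chart p))

lemma toLocal_apply (p : Projectivization ℂ (Fin 3 → ℂ)) (F : S) :
    toLocal p F = algebraMap _ LocalRing (dehom p.rep (chart p) F) := rfl

lemma toLocal_mem_maximalIdeal {p : Projectivization ℂ (Fin 3 → ℂ)} {F : S} {k : ℕ}
    (hF : F.IsHomogeneous k) : toLocal p F ∈ maximalIdeal LocalRing ↔ eval p.rep F = 0 := by
  rw [toLocal_apply, IsLocalization.AtPrime.to_map_mem_maximal_iff LocalRing originIdeal,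
    mem_originIdeal, constantCoeff_dehom_eq_zero_iff (rep_chart_ne_zero p) hF]

lemma isUnit_toLocal {p : Projectivization ℂ (Fin 3 → ℂ)} {F : S} {k : ℕ}
    (hF : F.IsHomogeneous k) (h : eval p.rep F ≠ 0) : IsUnit (toLocal p F) := by
  by_contra hu
  exact h ((toLocal_mem_maximalIdeal hF).mp hu)

lemma exists_linear_form {p q : Projectivization ℂ (Fin 3 → ℂ)} (hpq : p ≠ q) :
    ∃ l : S, l.IsHomogeneous 1 ∧ eval p.rep l ≠ 0 ∧ eval q.rep l = 0 := by
  by_contra! h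
  -- The forms `q_j X_i - q_i X_j` vanish at `q`; if all of them vanished at `p`, the two
  -- representatives would be proportional.
  have hmin : ∀ i j, q.rep j * p.rep i - q.rep i * p.rep j = 0 := by
    intro i j
    by_contra hne
    refine h (C (q.rep j) * X i - C (q.rep i) * X j)
      ((isHomogeneous_C_mul_X _ _).sub (isHomogeneous_C_mul_X _ _)) ?_ ?_
    · simpa using hne
    · simp
      ring
  apply hpq
  rw [← p.mk_rep, ← q.mk_rep, Projectivization.mk_eq_mk_iff']
  have hq := rep_chart_ne_zero q
  refine ⟨p.rep (chart q) / q.rep (chart q), funext fun j => ?_⟩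
  rw [Pi.smul_apply, smul_eq_mul]
  field_simp
  linear_combination hmin (chart q) j

lemma exists_toLocal_sub_mem (p : Projectivization ℂ (Fin 3 → ℂ)) {N k : ℕ} (hk : N ≤ k)
    (t : LocalRing) : ∃ H : S, H.IsHomogeneous k ∧
      toLocal p H - t ∈ maximalIdeal LocalRing ^ N := by
  obtain ⟨h, hdeg, hh⟩ := exists_algebraMap_sub_mem N t
  obtain ⟨H, hH, rfl⟩ := exists_dehom_eq p.rep (chart p) (hdeg.trans hk)
  exact ⟨H, hH, hh⟩

/-- Forms of large degree have arbitrary jets at finitely many points. -/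
lemma exists_forall_toLocal_sub_mem (P : Finset (Projectivization ℂ (Fin 3 → ℂ))) (N : ℕ) :
    ∃ k₀, ∀ k, k₀ ≤ k → ∀ t : Projectivization ℂ (Fin 3 → ℂ) → LocalRing,
      ∃ F : S, F.IsHomogeneous k ∧ ∀ p ∈ P, toLocal p F - t p ∈ maximalIdeal LocalRing ^ N := by
  classical
  have hl : ∀ p q : Projectivization ℂ (Fin 3 → ℂ), ∃ l : S, l.IsHomogeneous 1 ∧
      (p ≠ q → eval p.rep l ≠ 0 ∧ eval q.rep l = 0) := by
    intro p q
    by_cases hpq : p = q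
    · exact ⟨X 0, isHomogeneous_X _ _, fun h => absurd hpq h⟩
    · obtain ⟨l, h1, h2⟩ := exists_linear_form hpq
      exact ⟨l, h1, fun _ => h2⟩
  choose l hl1 hl2 using hl
  -- `G p` is a unit at `p` and vanishes to order `N` at the other points, so the jets can be
  -- prescribed one point at a time.
  let G : Projectivization ℂ (Fin 3 → ℂ) → S := fun p => ∏ q ∈ P.erase p, l p q ^ N
  have hGdeg : ∀ p ∈ P, (G p).IsHomogeneous ((P.card - 1) * N) := by
    intro p hp
    have := IsHomogeneous.prod (P.erase p) (fun q => l p q ^ N) (fun _ => 1 * N)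
      fun q _ => (hl1 p q).pow N
    rwa [Finset.sum_const, Finset.card_erase_of_mem hp, one_mul, smul_eq_mul] at this
  have hGunit : ∀ p ∈ P, IsUnit (toLocal p (G p)) := by
    intro p hp
    refine isUnit_toLocal (hGdeg p hp) ?_
    rw [map_prod]
    refine Finset.prod_ne_zero_iff.mpr fun q hq => ?_
    rw [map_pow]
    exact pow_ne_zero _ (hl2 p q (Finset.ne_of_mem_erase hq).symm).1
  have hGmem : ∀ p, ∀ q ∈ P, q ≠ p → toLocal q (G p) ∈ maximalIdeal LocalRing ^ N := by
    intro p q hq hqp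
    rw [map_prod, ← Finset.mul_prod_erase _ _ (Finset.mem_erase.mpr ⟨hqp, hq⟩), map_pow]
    exact Ideal.mul_mem_right _ _ (Ideal.pow_mem_pow
      ((toLocal_mem_maximalIdeal (hl1 p q)).mpr (hl2 p q hqp.symm).2) N)
  refine ⟨(P.card - 1) * N + N, fun k hk t => ?_⟩
  have hH : ∀ p, ∃ H : S, H.IsHomogeneous (k - (P.card - 1) * N) ∧
      toLocal p H - Ring.inverse (toLocal p (G p)) * t p ∈ maximalIdeal LocalRing ^ N :=
    fun p => exists_toLocal_sub_mem p (by omega) _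
  choose H hH1 hH2 using hH
  refine ⟨∑ p ∈ P, G p * H p, IsHomogeneous.sum _ _ _ fun p hp => ?_, fun p hp => ?_⟩
  · have := (hGdeg p hp).mul (hH1 p)
    rwa [Nat.add_sub_cancel' (by omega)] at this
  · rw [map_sum, ← Finset.add_sum_erase _ _ hp, add_sub_right_comm]
    refine Ideal.add_mem _ ?_ (Ideal.sum_mem _ fun q hq => ?_)
    · have := Ideal.mul_mem_left _ (toLocal p (G p)) (hH2 p)
      rwa [mul_sub, ← mul_assoc, Ring.mul_inverse_cancel _ (hGunit p hp), one_mul,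
        ← map_mul] at this
    · rw [map_mul]
      exact Ideal.mul_mem_right _ _ (hGmem q p hp (Finset.ne_of_mem_erase hq).symm)

lemma finiteDimensional_of_map_eq_top {V W : Type*} [AddCommGroup V] [Module ℂ V]
    [AddCommGroup W] [Module ℂ W] {g : V →ₗ[ℂ] W} {p : Submodule ℂ V} [FiniteDimensional ℂ p]
    (h : p.map g = ⊤) : FiniteDimensional ℂ W := by
  refine Module.Finite.of_surjective (g.domRestrict p) (LinearMap.range_eq_top.mp ?_)
  rw [LinearMap.range_domRestrict, h]

section
variable {R T : Type*} [CommRing R] [Algebra ℂ R]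

/-- The images of a polynomial under finitely many homomorphisms, modulo given ideals. -/
noncomputable def residues (ψ : T → S →ₐ[ℂ] R) (P : Finset T) (I : T → Ideal R) :
    S →ₗ[ℂ] (∀ p : P, R ⧸ I p) :=
  LinearMap.pi fun p => (Ideal.Quotient.mkₐ ℂ (I p)).toLinearMap ∘ₗ (ψ p.1).toLinearMap

variable {ψ : T → S →ₐ[ℂ] R} {P : Finset T} {I : T → Ideal R} {k : ℕ}

lemma residues_apply (F : S) (p : P) :
    residues ψ P I F p = Ideal.Quotient.mk (I p) (ψ p.1 F) := rfl

lemma mem_ker_residues {F : S} :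
    F ∈ LinearMap.ker (residues ψ P I) ↔ ∀ p ∈ P, ψ p F ∈ I p := by
  rw [LinearMap.mem_ker, funext_iff, Subtype.forall]
  refine forall_congr' fun p => forall_congr' fun hp => ?_
  rw [residues_apply, Pi.zero_apply, Ideal.Quotient.eq_zero_iff_mem]

lemma map_residues_eq_top
    (h : ∀ t : T → R, ∃ F : S, F.IsHomogeneous k ∧ ∀ p ∈ P, ψ p F - t p ∈ I p) :
    (homogeneousSubmodule (Fin 3) ℂ k).map (residues ψ P I) = ⊤ := by
  classical
  rw [eq_top_iff]
  intro s _
  choose t ht using fun p : P => Ideal.Quotient.mk_surjective (s p)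
  obtain ⟨F, hF, hFt⟩ := h fun p => if h : p ∈ P then t ⟨p, h⟩ else 0
  refine ⟨F, hF, funext fun p => ?_⟩
  have h1 := hFt p p.2
  rw [dif_pos p.2] at h1
  rw [residues_apply, ← ht p, Ideal.Quotient.eq]
  exact h1

lemma finite_quotient_of_map_eq_top
    (h : (homogeneousSubmodule (Fin 3) ℂ k).map (residues ψ P I) = ⊤) {p : T} (hp : p ∈ P) :
    FiniteDimensional ℂ (R ⧸ I p) := by
  have h1 := finiteDimensional_of_map_eq_top h
  exact Module.Finite.of_surjective
    (LinearMap.proj (R := ℂ) (φ := fun p : P => R ⧸ I p.1) ⟨p, hp⟩) (LinearMap.proj_surjective _)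

lemma sum_finrank_add_of_map_eq_top
    (h : (homogeneousSubmodule (Fin 3) ℂ k).map (residues ψ P I) = ⊤) :
    ∑ p ∈ P, Module.finrank ℂ (R ⧸ I p) +
      Module.finrank ℂ (homogeneousSubmodule (Fin 3) ℂ k ⊓ LinearMap.ker (residues ψ P I) :
        Submodule ℂ S) = hf k 0 := by
  have := fun p : P => finite_quotient_of_map_eq_top h p.2
  have h1 := finrank_map_add_finrank_inf_ker (residues ψ P I) (homogeneousSubmodule (Fin 3) ℂ k)
  rw [h, finrank_top, Module.finrank_pi_fintype, finrank_homogeneousSubmodule] at h1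
  rw [← Finset.sum_coe_sort P fun p => Module.finrank ℂ (R ⧸ I p)]
  exact h1

end

section
variable {P : Finset (Projectivization ℂ (Fin 3 → ℂ))}
  {I : Projectivization ℂ (Fin 3 → ℂ) → Ideal LocalRing} {N : ℕ}

lemma exists_map_residues_eq_top (hI : ∀ p ∈ P, maximalIdeal LocalRing ^ N ≤ I p) :
    ∃ k₀, ∀ k, k₀ ≤ k → (homogeneousSubmodule (Fin 3) ℂ k).map (residues toLocal P I) = ⊤ := by
  obtain ⟨k₀, hk₀⟩ := exists_forall_toLocal_sub_mem P N
  refine ⟨k₀, fun k hk => map_residues_eq_top fun t => ?_⟩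
  obtain ⟨F, hF, h⟩ := hk₀ k hk t
  exact ⟨F, hF, fun p hp => hI p hp (h p hp)⟩

lemma finite_quotient (hI : ∀ p ∈ P, maximalIdeal LocalRing ^ N ≤ I p)
    {p : Projectivization ℂ (Fin 3 → ℂ)} (hp : p ∈ P) :
    FiniteDimensional ℂ (LocalRing ⧸ I p) := by
  obtain ⟨k₀, hk₀⟩ := exists_map_residues_eq_top hI
  exact finite_quotient_of_map_eq_top (hk₀ k₀ le_rfl) hp

lemma exists_sum_finrank_add (hI : ∀ p ∈ P, maximalIdeal LocalRing ^ N ≤ I p) :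
    ∃ k₀, ∀ k, k₀ ≤ k → ∑ p ∈ P, Module.finrank ℂ (LocalRing ⧸ I p) +
      Module.finrank ℂ (homogeneousSubmodule (Fin 3) ℂ k ⊓ LinearMap.ker (residues toLocal P I) :
        Submodule ℂ S) = hf k 0 := by
  obtain ⟨k₀, hk₀⟩ := exists_map_residues_eq_top hI
  exact ⟨k₀, fun k hk => sum_finrank_add_of_map_eq_top (hk₀ k hk)⟩

end

/-! ### Finiteness of the singular locus -/

/-- The ideal of the local ring at `p` generated by the partial derivatives of `f`. -/
noncomputable def locJac (f : S) (p : Projectivization ℂ (Fin 3 → ℂ)) : Ideal LocalRing :=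
  Ideal.map (toLocal p) (LinearMap.range (gradMap f))

lemma jacPiece_le_ker_residues {f : S} {k : ℕ} {P : Finset (Projectivization ℂ (Fin 3 → ℂ))}
    {I : Projectivization ℂ (Fin 3 → ℂ) → Ideal LocalRing} (hI : ∀ p ∈ P, locJac f p ≤ I p) :
    jacPiece f k ≤ homogeneousSubmodule (Fin 3) ℂ k ⊓ LinearMap.ker (residues toLocal P I) := by
  rintro F ⟨hF, hk⟩
  exact ⟨hk, mem_ker_residues.mpr fun p hp => hI p hp (Ideal.mem_map_of_mem (toLocal p) hF)⟩

section
variable {f : S} {d : ℕ}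

/-- For large `k` the forms of degree `k` surject onto the product of the quotients and the Jacobian
ideal maps to zero, so the sum is at most `dim M(f)_k`. -/
lemma sum_finrank_le (hd : d ≠ 0) (hf' : f.IsHomogeneous d) (hred : Squarefree f)
    {P : Finset (Projectivization ℂ (Fin 3 → ℂ))}
    {I : Projectivization ℂ (Fin 3 → ℂ) → Ideal LocalRing} {N : ℕ}
    (hI : ∀ p ∈ P, maximalIdeal LocalRing ^ N ≤ I p) (hJ : ∀ p ∈ P, locJac f p ≤ I p) :
    ∑ p ∈ P, Module.finrank ℂ (LocalRing ⧸ I p) ≤ (d - 1) ^ 2 := by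
  obtain ⟨k₀, hk₀⟩ := exists_sum_finrank_add hI
  have h1 := hk₀ (k₀ + 2 * (d - 1)) (by omega)
  set k := k₀ + 2 * (d - 1)
  have : FiniteDimensional ℂ (homogeneousSubmodule (Fin 3) ℂ k ⊓
      LinearMap.ker (residues toLocal P I) :
        Submodule ℂ S) := Submodule.finiteDimensional_inf_left _ _
  have h2 := Submodule.finrank_mono (jacPiece_le_ker_residues (k := k) hJ)
  have h3 := two_mul_hf_le hd hf' hred k
  have h4 := two_mul_hf' (k := k) (a := d - 1) (by omega)
  have h5 := two_mul_hf' (k := k) (a := 2 * (d - 1)) (by omega)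
  have h6 := two_mul_hf' (k := k) (Nat.zero_le k)
  zify at h1 h2 h3 ⊢
  push_cast at *
  nlinarith

/-- Each such point contributes at least 1 to the bound, with the maximal ideal as `I`. -/
lemma finite_locJac_ne_top (hd : d ≠ 0) (hf' : f.IsHomogeneous d) (hred : Squarefree f) :
    {p | locJac f p ≠ ⊤}.Finite := by
  by_contra hinf
  obtain ⟨P, hP, hcard⟩ := Set.Infinite.exists_subset_card_eq hinf ((d - 1) ^ 2 + 1)
  have hI : ∀ p ∈ P, maximalIdeal LocalRing ^ 1 ≤ maximalIdeal LocalRing :=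
    fun _ _ => (pow_one _).le
  have h1 := sum_finrank_le hd hf' hred (P := P) (I := fun _ => maximalIdeal LocalRing) hI
    fun p hp => le_maximalIdeal (hP hp)
  have h2 : ∀ p ∈ P, 1 ≤ Module.finrank ℂ (LocalRing ⧸ maximalIdeal LocalRing) := by
    intro p hp
    have := finite_quotient hI hp
    exact Module.finrank_pos
  have h3 := Finset.sum_le_sum h2
  rw [Finset.sum_const, hcard, smul_eq_mul] at h3
  omega

/-- The lengths of the quotients by `locJac f p ⊔ 𝔪 ^ N` increase with `N` and are bounded, so two
consecutive ones agree. Then `𝔪 ^ N ≤ locJac f p ⊔ 𝔪 ^ (N + 1)`, and Nakayama's lemma removes the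
second term. -/
lemma exists_maximalIdeal_pow_le_locJac (hd : d ≠ 0) (hf' : f.IsHomogeneous d)
    (hred : Squarefree f) (p : Projectivization ℂ (Fin 3 → ℂ)) :
    ∃ N, maximalIdeal LocalRing ^ N ≤ locJac f p := by
  let I : ℕ → Ideal LocalRing := fun N => locJac f p ⊔ maximalIdeal LocalRing ^ N
  have hI : ∀ N, ∀ q ∈ ({p} : Finset (Projectivization ℂ (Fin 3 → ℂ))),
      maximalIdeal LocalRing ^ N ≤ I N := fun N q _ => le_sup_right
  have hfin : ∀ N, FiniteDimensional ℂ (LocalRing ⧸ I N) := fun N =>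
    finite_quotient (I := fun _ => I N) (hI N) (Finset.mem_singleton_self p)
  have hle : ∀ N, Module.finrank ℂ (LocalRing ⧸ I N) ≤ (d - 1) ^ 2 := by
    intro N
    have := sum_finrank_le hd hf' hred (I := fun _ => I N) (hI N) (by
      intro q hq
      rw [Finset.mem_singleton.mp hq]
      exact le_sup_left)
    rwa [Finset.sum_singleton] at this
  have hanti : ∀ N, I (N + 1) ≤ I N := fun N =>
    sup_le_sup_left (Ideal.pow_le_pow_right (by omega)) _
  let φ : ∀ N, (LocalRing ⧸ I (N + 1)) →ₗ[ℂ] (LocalRing ⧸ I N) := fun N =>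
    (Ideal.Quotient.factorₐ ℂ (hanti N)).toLinearMap
  have hφ : ∀ N, Function.Surjective (φ N) := fun N => Ideal.Quotient.factor_surjective (hanti N)
  have hstab : ∃ N, Module.finrank ℂ (LocalRing ⧸ I N) =
      Module.finrank ℂ (LocalRing ⧸ I (N + 1)) := by
    by_contra! hne
    have hlt : ∀ N, N ≤ Module.finrank ℂ (LocalRing ⧸ I N) := by
      intro N
      induction N with
      | zero => omega
      | succ N ih =>
        have h1 := LinearMap.finrank_le_finrank_of_surjective (hφ N)
        have h2 := hne N
        omega
    have := hlt ((d - 1) ^ 2 + 1)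
    have := hle ((d - 1) ^ 2 + 1)
    omega
  obtain ⟨N, hN⟩ := hstab
  have hinj := (LinearMap.injective_iff_surjective_of_finrank_eq_finrank hN.symm).mpr (hφ N)
  have hIN : I N ≤ I (N + 1) := by
    intro x hx
    rw [← Ideal.Quotient.eq_zero_iff_mem]
    apply hinj
    rw [map_zero]
    exact Ideal.Quotient.eq_zero_iff_mem.mpr hx
  refine ⟨N, Submodule.le_of_le_smul_of_le_jacobson_bot (I := maximalIdeal LocalRing)
    (IsNoetherian.noetherian _) (maximalIdeal_le_jacobson _) ?_⟩
  rw [smul_eq_mul, ← pow_succ']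
  exact le_sup_right.trans hIN

end

end

section
open IsLocalRing

/-! ### The Tjurina numbers and the Jacobian algebra -/

lemma pderiv_dehom (v : Fin 3 → ℂ) (i : Fin 3) (j : Fin 2) (F : S) :
    pderiv j (dehom v i F) = dehom v i (pderiv (i.succAbove j) F) := by
  induction F using MvPolynomial.induction_on with
  | C a => rw [dehom_C, pderiv_C, pderiv_C, map_zero]
  | add p q hp hq => simp only [map_add, hp, hq]
  | mul_X p k hp =>
    have hX : pderiv j (dehom v i (X k)) = dehom v i (pderiv (i.succAbove j) (X k)) := by
      rcases Fin.eq_self_or_eq_succAbove i k with rfl | ⟨l, rfl⟩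
      · rw [dehom_X_self, pderiv_one, pderiv_X_of_ne (Fin.succAbove_ne k j).symm, map_zero]
      · rw [dehom_X_succAbove, map_add, pderiv_C, add_zero]
        by_cases h : j = l
        · subst h
          rw [pderiv_X_self, pderiv_X_self, map_one]
        · rw [pderiv_X_of_ne (Ne.symm h), pderiv_X_of_ne, map_zero]
          exact fun h' => h (Fin.succAbove_right_injective h').symm
    rw [map_mul, Derivation.leibniz, Derivation.leibniz, hX, hp]
    simp only [smul_eq_mul, map_add, map_mul]

lemma range_gradMap (f : S) :
    LinearMap.range (gradMap f) = Ideal.span (Set.range fun k => pderiv k f) :=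
  Fintype.range_linearCombination S _

lemma mem_locJac (f : S) (p : Projectivization ℂ (Fin 3 → ℂ)) (k : Fin 3) :
    toLocal p (pderiv k f) ∈ locJac f p := by
  refine Ideal.mem_map_of_mem (toLocal p) ?_
  rw [range_gradMap]
  exact Ideal.subset_span ⟨k, rfl⟩

lemma locJac_eq (f : S) (p : Projectivization ℂ (Fin 3 → ℂ)) :
    locJac f p = Ideal.span (Set.range fun k => toLocal p (pderiv k f)) := by
  rw [locJac, range_gradMap, Ideal.map_span, ← Set.range_comp]
  rfl

/-- Euler's formula in an affine chart. -/
lemma toLocal_euler {f : S} {d : ℕ} (hf' : f.IsHomogeneous d)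
    (p : Projectivization ℂ (Fin 3 → ℂ)) :
    (d : LocalRing) * toLocal p f = toLocal p (pderiv (chart p) f) +
      ∑ j, toLocal p (X ((chart p).succAbove j)) *
        toLocal p (pderiv ((chart p).succAbove j) f) := by
  have h := congrArg (toLocal p) hf'.sum_X_mul_pderiv
  rw [nsmul_eq_mul, map_mul, map_natCast] at h
  rw [← h, Fin.sum_univ_succAbove _ (chart p), map_add, map_mul, map_sum]
  simp only [map_mul]
  congr 1
  rw [toLocal_apply p (X _), dehom_X_self, map_one, one_mul]

/-- Since `d` is invertible, Euler's formula expresses `f` through the partial derivatives. Read the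
other way, it expresses the derivative along the chart variable through `f` and the other two. -/
lemma tjurinaAt_eq {f : S} {d : ℕ} (hd : d ≠ 0) (hf' : f.IsHomogeneous d)
    (p : Projectivization ℂ (Fin 3 → ℂ)) :
    tjurinaAt f p = Module.finrank ℂ (LocalRing ⧸ locJac f p) := by
  have hg : localEquation f p.rep (chart p) = dehom p.rep (chart p) f := rfl
  have hE := toLocal_euler hf' p
  have hspan : Ideal.span ({algebraMap _ LocalRing (dehom p.rep (chart p) f),
      algebraMap _ LocalRing (pderiv 0 (dehom p.rep (chart p) f)),
      algebraMap _ LocalRing (pderiv 1 (dehom p.rep (chart p) f))} : Set LocalRing) =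
      locJac f p := by
    rw [pderiv_dehom, pderiv_dehom, ← toLocal_apply, ← toLocal_apply, ← toLocal_apply]
    apply le_antisymm
    · rw [Ideal.span_le]
      rintro x (rfl | rfl | rfl)
      · have h1 : (d : LocalRing) * toLocal p f ∈ locJac f p := by
          rw [hE]
          exact Ideal.add_mem _ (mem_locJac f p _)
            (Ideal.sum_mem _ fun j _ => Ideal.mul_mem_left _ _ (mem_locJac f p _))
        have h2 : toLocal p f =
            algebraMap ℂ LocalRing (d : ℂ)⁻¹ * ((d : LocalRing) * toLocal p f) := by
          rw [← mul_assoc, ← map_natCast (algebraMap ℂ LocalRing), ← map_mul,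
            inv_mul_cancel₀ (Nat.cast_ne_zero.mpr hd), map_one, one_mul]
        rw [SetLike.mem_coe, h2]
        exact Ideal.mul_mem_left _ _ h1
      · exact mem_locJac f p _
      · exact mem_locJac f p _
    · have hj : ∀ j : Fin 2, toLocal p (pderiv ((chart p).succAbove j) f) ∈ Ideal.span
          ({toLocal p f, toLocal p (pderiv ((chart p).succAbove 0) f),
            toLocal p (pderiv ((chart p).succAbove 1) f)} : Set LocalRing) := by
        intro j
        apply Ideal.subset_span
        fin_cases j <;> simp
      rw [locJac_eq, Ideal.span_le]
      rintro _ ⟨k, rfl⟩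
      rcases Fin.eq_self_or_eq_succAbove (chart p) k with rfl | ⟨j, rfl⟩
      · have h1 := eq_sub_of_add_eq hE.symm
        dsimp only
        rw [SetLike.mem_coe, h1]
        refine Ideal.sub_mem _ (Ideal.mul_mem_left _ _ (Ideal.subset_span (by simp)))
          (Ideal.sum_mem _ fun j _ => Ideal.mul_mem_left _ _ (hj j))
      · exact hj j
  rw [← hspan]
  rfl

/-- A form whose germ at `p` lies in the Jacobian ideal is multiplied into the Jacobian ideal by
some form that does not vanish at `p`. -/
lemma exists_mul_mem_of_toLocal_mem {f F : S} {d k : ℕ} (hf' : f.IsHomogeneous d)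
    (hF : F.IsHomogeneous k) {p : Projectivization ℂ (Fin 3 → ℂ)} (h : toLocal p F ∈ locJac f p) :
    ∃ (G : S) (l : ℕ), G.IsHomogeneous l ∧ eval p.rep G ≠ 0 ∧
      G * F ∈ LinearMap.range (gradMap f) := by
  have h1 : locJac f p = Ideal.map (algebraMap _ LocalRing)
      (Ideal.span (Set.range fun k => dehom p.rep (chart p) (pderiv k f))) := by
    rw [locJac_eq, Ideal.map_span, ← Set.range_comp]
    rfl
  rw [h1, toLocal_apply, IsLocalization.algebraMap_mem_map_algebraMap_iff originIdeal.primeCompl]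
    at h
  obtain ⟨s, hs, hsF⟩ := h
  obtain ⟨a, ha⟩ := (Submodule.mem_span_range_iff_exists_fun _).mp hsF
  let K := s.totalDegree + ∑ i, (a i).totalDegree
  have haK : ∀ i, (a i).totalDegree ≤ K := by
    intro i
    have := Finset.single_le_sum (f := fun i => (a i).totalDegree) (fun _ _ => Nat.zero_le _)
      (Finset.mem_univ i)
    exact this.trans (Nat.le_add_left _ _)
  -- The degrees are chosen so that `G * F` and all `H i * pderiv i f` have the same degree `K + (d
  -- - 1) + k`; the affine identity then lifts to forms.
  obtain ⟨G, hG, hGs⟩ := exists_dehom_eq p.rep (chart p) (k := K + (d - 1)) (h := s) (by omega)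
  have hH : ∀ i, ∃ H : S, H.IsHomogeneous (K + k) ∧ dehom p.rep (chart p) H = a i := fun i =>
    exists_dehom_eq _ _ ((haK i).trans (Nat.le_add_right _ _))
  choose H hH hHa using hH
  refine ⟨G, _, hG, ?_, ?_⟩
  · intro h0
    exact hs (mem_originIdeal.mpr (hGs ▸
      (constantCoeff_dehom_eq_zero_iff (rep_chart_ne_zero p) hG).mpr h0))
  · have hzero : G * F - ∑ i, H i * pderiv i f = 0 := by
      refine eq_zero_of_dehom_eq_zero (v := p.rep) (i := chart p) (k := K + (d - 1) + k)
        (IsHomogeneous.sub (hG.mul hF) (IsHomogeneous.sum _ _ _ fun i _ => ?_)) ?_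
      · rw [show K + (d - 1) + k = K + k + (d - 1) by omega]
        exact (hH i).mul hf'.pderiv
      · rw [map_sub, map_mul, hGs, map_sum, sub_eq_zero, ← ha]
        refine Finset.sum_congr rfl fun i _ => ?_
        rw [map_mul, hHa, smul_eq_mul]
    rw [sub_eq_zero.mp hzero]
    exact ⟨H, gradMap_apply f H⟩

/-- A form that lies locally in the Jacobian ideal lies in its saturation. -/
lemma exists_pow_mul_mem {f F : S} {d k : ℕ} (hf' : f.IsHomogeneous d) (hF : F.IsHomogeneous k)
    (h : ∀ p, toLocal p F ∈ locJac f p) :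
    ∃ N, ∀ G ∈ idealOfVars (Fin 3) ℂ ^ N, G * F ∈ LinearMap.range (gradMap f) := by
  let Q : Ideal S := Submodule.comap (LinearMap.mulRight S F) (LinearMap.range (gradMap f))
  have hQ : ∀ G, G ∈ Q ↔ G * F ∈ LinearMap.range (gradMap f) := fun G => Iff.rfl
  -- Nullstellensatz: at every point of the plane some member of `Q` does not vanish, so `Q` has no
  -- common zero except possibly the origin.
  have hrad : idealOfVars (Fin 3) ℂ ≤ Q.radical := by
    rw [← vanishingIdeal_zeroLocus_eq_radical (K := ℂ), idealOfVars, Ideal.span_le]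
    rintro _ ⟨i, rfl⟩
    rw [SetLike.mem_coe, mem_vanishingIdeal_iff]
    intro v hv
    by_cases hv0 : v = 0
    · simp [hv0]
    exfalso
    obtain ⟨a, ha⟩ := Projectivization.exists_smul_eq_mk_rep ℂ v hv0
    obtain ⟨G, l, hG, hne, hGF⟩ := exists_mul_mem_of_toLocal_mem hf' hF
      (h (Projectivization.mk ℂ v hv0))
    apply hne
    rw [← ha, Units.smul_def, eval_smul_of_isHomogeneous hG]
    have := mem_zeroLocus_iff.mp hv G hGF
    rw [aeval_eq_eval] at this
    rw [this, mul_zero]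
  obtain ⟨N, hN⟩ := Ideal.exists_pow_le_of_le_radical_of_fg hrad (IsNoetherian.noetherian _)
  exact ⟨N, fun G hG => hN hG⟩

lemma hcomp_mem_range_gradMap {f F : S} {d : ℕ} (hf' : f.IsHomogeneous d)
    (hF : F ∈ LinearMap.range (gradMap f)) (k : ℕ) :
    hcomp k F ∈ LinearMap.range (gradMap f) := by
  obtain ⟨v, rfl⟩ := hF
  exact ⟨_, (hcomp_gradMap hf' k v).symm⟩

/-- In large degrees the Jacobian ideal agrees with its saturation. -/
lemma exists_saturation_le {f : S} {d : ℕ} (hf' : f.IsHomogeneous d) :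
    ∃ k₀, ∀ k, k₀ ≤ k → ∀ F : S, F.IsHomogeneous k →
      (∃ N, ∀ G ∈ idealOfVars (Fin 3) ℂ ^ N, G * F ∈ LinearMap.range (gradMap f)) →
      F ∈ LinearMap.range (gradMap f) := by
  let J : Ideal S := LinearMap.range (gradMap f)
  let Q : ℕ →o Ideal S :=
    { toFun := fun N =>
        { carrier := {F | ∀ G ∈ idealOfVars (Fin 3) ℂ ^ N, G * F ∈ J}
          zero_mem' := fun G _ => by simp
          add_mem' := fun ha hb G hG => by
            rw [mul_add]
            exact Ideal.add_mem _ (ha G hG) (hb G hG)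
          smul_mem' := fun c F hF G hG => by
            rw [smul_eq_mul, mul_left_comm]
            exact Ideal.mul_mem_left _ _ (hF G hG) }
      monotone' := fun N N' h F hF G hG => hF G (Ideal.pow_le_pow_right h hG) }
  have hQ : ∀ N F, F ∈ Q N ↔ ∀ G ∈ idealOfVars (Fin 3) ℂ ^ N, G * F ∈ J := fun _ _ => Iff.rfl
  -- The chain of colon ideals stabilizes, so the saturation is the colon by a single power `N`.
  obtain ⟨N, hN⟩ := monotone_stabilizes_iff_noetherian.mpr (inferInstance : IsNoetherian S S) Q
  obtain ⟨t, ht⟩ := (IsNoetherian.noetherian (Q N) : (Q N).FG)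
  refine ⟨N + t.sup totalDegree, fun k hk F hF ⟨N', hFN'⟩ => ?_⟩
  have hFN : F ∈ Q N := by
    have h1 : F ∈ Q N' := hFN'
    rw [hN (max N N') (le_max_left _ _)]
    exact Q.monotone (le_max_right _ _) h1
  rw [← ht, Submodule.mem_span_finset] at hFN
  obtain ⟨a, -, ha⟩ := hFN
  -- The part of `a g` of degree below `N` cannot contribute to degree `k ≥ N + deg g`; the rest
  -- lies in the `N`-th power and multiplies `g` into `J`.
  let low : S → S := fun g => ∑ i ∈ Finset.range N, homogeneousComponent i (a g)
  have hhigh : ∀ g, a g - low g ∈ idealOfVars (Fin 3) ℂ ^ N := by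
    intro g
    rw [mem_pow_idealOfVars_iff']
    intro x hx
    simp only [low]
    rw [coeff_sub, coeff_sum]
    simp only [coeff_homogeneousComponent]
    simp [hx]
  have h1 : F - ∑ g ∈ t, low g * g ∈ J := by
    rw [← ha, ← Finset.sum_sub_distrib]
    refine Ideal.sum_mem _ fun g hg => ?_
    rw [smul_eq_mul, ← sub_mul]
    have hgQ : g ∈ Q N := ht ▸ Submodule.subset_span hg
    exact hgQ _ (hhigh g)
  have h2 := hcomp_mem_range_gradMap hf' h1 k
  have h3 : hcomp k (∑ g ∈ t, low g * g) = 0 := by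
    rw [map_sum]
    refine Finset.sum_eq_zero fun g hg => ?_
    rw [hcomp, if_pos (by omega), Int.toNat_natCast]
    simp only [low]
    rw [Finset.sum_mul, map_sum]
    refine Finset.sum_eq_zero fun i hi => homogeneousComponent_eq_zero _ _ ?_
    have h4 := totalDegree_mul (homogeneousComponent i (a g)) g
    have h5 := (homogeneousComponent_isHomogeneous i (a g)).totalDegree_le
    have h6 : g.totalDegree ≤ t.sup totalDegree := Finset.le_sup (f := totalDegree) hg
    have h7 := Finset.mem_range.mp hi
    omega
  rwa [map_sub, h3, sub_zero, (isHomogeneousInt_natCast.mpr hF).hcomp_eq] at h2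

/-- The total Tjurina number is the dimension of the graded pieces of large degree of the Jacobian
algebra. -/
theorem exists_totalTjurina_add {f : S} {d : ℕ} (hd : d ≠ 0) (hf' : f.IsHomogeneous d)
    (hred : Squarefree f) : ∃ k₀, ∀ k, k₀ ≤ k →
      totalTjurina f + Module.finrank ℂ (jacPiece f k) = hf k 0 := by
  have hfin := finite_locJac_ne_top hd hf' hred
  choose N hN using exists_maximalIdeal_pow_le_locJac hd hf' hred
  let P := hfin.toFinset
  have hP : ∀ p, p ∉ P → locJac f p = ⊤ := by
    intro p hp
    by_contra h
    exact hp (hfin.mem_toFinset.mpr h)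
  have hI : ∀ p ∈ P, maximalIdeal LocalRing ^ (P.sup N) ≤ locJac f p := fun p hp =>
    (Ideal.pow_le_pow_right (Finset.le_sup hp)).trans (hN p)
  obtain ⟨k₁, hk₁⟩ := exists_sum_finrank_add hI
  obtain ⟨k₂, hk₂⟩ := exists_saturation_le hf'
  refine ⟨k₁ + k₂, fun k hk => ?_⟩
  have hτ : totalTjurina f = ∑ p ∈ P, Module.finrank ℂ (LocalRing ⧸ locJac f p) := by
    rw [totalTjurina, finsum_eq_sum_of_support_subset (s := P)]
    · exact Finset.sum_congr rfl fun p _ => tjurinaAt_eq hd hf' p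
    · intro p hp
      by_contra h
      apply hp
      rw [tjurinaAt_eq hd hf', hP p h]
      have : Subsingleton (LocalRing ⧸ (⊤ : Ideal LocalRing)) :=
        Ideal.Quotient.subsingleton_iff.mpr rfl
      exact Module.finrank_zero_of_subsingleton
  -- Outside `P` the local ideal is the whole ring and imposes no condition.
  have hker : homogeneousSubmodule (Fin 3) ℂ k ⊓
      LinearMap.ker (residues toLocal P fun p => locJac f p) = jacPiece f k := by
    apply le_antisymm
    · rintro F ⟨hF, hFk⟩
      refine ⟨hk₂ k (by omega) F hF (exists_pow_mul_mem hf' hF fun p => ?_), hF⟩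
      by_cases hp : p ∈ P
      · exact mem_ker_residues.mp hFk p hp
      · rw [hP p hp]
        exact Submodule.mem_top
    · exact jacPiece_le_ker_residues fun _ _ => le_rfl
  rw [hτ, ← hker]
  exact hk₁ k (by omega)

end

/-! ### Minimal resolutions and classes of curves -/

section
variable {f : S} {d n : ℕ} {e : Fin (n + 2) → ℕ} {c : Fin n → ℕ}

/-- `A` is minimal because its relations are combinations of the columns of `B`, whose entries have
no constant term. -/
lemma HasMinimalResolution.exists_matrices (h : HasMinimalResolution f d e c) (hd : 1 ≤ d) :
    ∃ (A : Matrix (Fin 3) (Fin (n + 2)) S) (B : Matrix (Fin (n + 2)) (Fin n) S),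
      (∀ k i, (A k i).IsHomogeneous (e i)) ∧ IsMinimalMatrix A ∧
      IsGradedMatrix (fun i => d - 1 + e i) c B ∧ Function.Injective B.mulVecLin ∧
      LinearMap.range B.mulVecLin = LinearMap.ker A.mulVecLin ∧
      LinearMap.range A.mulVecLin = syzygies f := by
  obtain ⟨-, -, A, B, hA, hB, hinj, hBA, hAf, -, -, hB0⟩ := h
  rw [LinearMap.exact_iff] at hBA hAf
  refine ⟨A, B, hA, fun a ha j => ?_, fun i j => ?_, hinj, hBA.symm, hAf.symm⟩
  · have hmem : a ∈ LinearMap.range B.mulVecLin := hBA ▸ LinearMap.mem_ker.mpr ha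
    obtain ⟨b, rfl⟩ := hmem
    rw [Matrix.mulVecLin_apply, Matrix.mulVec, dotProduct, map_sum]
    exact Finset.sum_eq_zero fun i _ => by rw [map_mul, hB0, zero_mul]
  · have := hB i j
    push_cast [hd]
    exact this

lemma HasMinimalResolution.isExponents (h : HasMinimalResolution f d e c) (hd : 1 ≤ d) :
    IsExponents f e := by
  obtain ⟨A, B, hA, hm, -, -, -, hAf⟩ := h.exists_matrices hd
  exact isExponents_of_matrix h.1 hA hm hAf

/-- The degrees in a minimal graded free resolution are well defined. -/
lemma HasMinimalResolution.unique {n' : ℕ} {e' : Fin (n' + 2) → ℕ} {c' : Fin n' → ℕ}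
    (h : HasMinimalResolution f d e c) (h' : HasMinimalResolution f d e' c') (hd : 1 ≤ d)
    (hf' : f.IsHomogeneous d) :
    ∃ hn : n = n', (∀ i, e i = e' (Fin.cast (by rw [hn]) i)) ∧
      ∀ j, c j = c' (Fin.cast hn j) := by
  obtain ⟨hmm, hee⟩ := (h.isExponents hd).unique (h'.isExponents hd)
  obtain rfl : n = n' := by omega
  refine ⟨rfl, hee, fun j => ?_⟩
  obtain rfl : e = e' := funext hee
  obtain ⟨A, B, hA, hm, hB, hinj, hBA, hAf⟩ := h.exists_matrices hd
  obtain ⟨A', B', hA', hm', hB', hinj', hBA', hAf'⟩ := h'.exists_matrices hd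
  refine congrFun (monotone_eq_of_sum_hf_eq h.2.1 h'.2.1 fun k => ?_) j
  -- Both resolutions compute the same Hilbert function with the same `e`, so the contributions of
  -- the `c_j` agree.
  have h1 := finrank_jacPiece_add hf' ((isGradedMatrix_add_iff _).mpr hA) hB hinj hBA hAf k
  have h2 := finrank_jacPiece_add hf' ((isGradedMatrix_add_iff _).mpr hA') hB' hinj' hBA' hAf' k
  omega

/-- Minimal second syzygies are free, and the rank count forces their number to be `n`. The
hypotheses `2 ≤ d` and `0 < e 0` keep constants out of the first two maps. -/
lemma IsExponents.exists_hasMinimalResolution (h : IsExponents f e) (hd : 2 ≤ d)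
    (hf' : f.IsHomogeneous d) (hred : Squarefree f) (he : 0 < e 0) :
    ∃ c : Fin n → ℕ, HasMinimalResolution f d e c := by
  obtain ⟨A, hA, hm, hAf⟩ := h.exists_matrix (d - 1)
  obtain ⟨n', c, B, hc, hB, hmB, hBA⟩ := exists_minimal_generators (fun i => d - 1 + e i)
    (LinearMap.ker A.mulVecLin) (fun v hv k => by
      rw [LinearMap.mem_ker, Matrix.mulVecLin_apply] at hv ⊢
      rw [← hA.vcomp_mulVec, hv, map_zero])
  have hinj := hmB.injective hAf hBA
  obtain ⟨hn, -, -⟩ := resolution_numerics (by omega) hf' hred hA hB hinj hBA hAf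
  obtain rfl : n = n' := by omega
  have hA' := (isGradedMatrix_add_iff _).mp hA
  refine ⟨c, h.1, hc, A, B, hA', fun i j => ?_, hinj, LinearMap.exact_iff.mpr hBA.symm,
    LinearMap.exact_iff.mpr hAf.symm, fun k => ?_, fun k i => ?_, fun i j => ?_⟩
  · have := hB i j
    have h1 : ((d - 1 + e i : ℕ) : ℤ) = (d : ℤ) - 1 + e i := by omega
    rwa [h1] at this
  · exact (isHomogeneousInt_natCast.mpr hf'.pderiv).constantCoeff_eq_zero (by omega)
  · refine (isHomogeneousInt_natCast.mpr (hA' k i)).constantCoeff_eq_zero ?_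
    have := h.1 (Fin.zero_le i)
    omega
  · have h1 : A.mulVecLin (B.mulVecLin (Pi.single j 1)) = 0 := by
      have : B.mulVecLin (Pi.single j 1) ∈ LinearMap.ker A.mulVecLin :=
        hBA ▸ LinearMap.mem_range_self _ _
      exact this
    have h2 := hm _ h1 i
    rwa [Matrix.mulVecLin_apply, Matrix.mulVec_single_one] at h2

end

lemma hasPartition_of_length_eq {f : S} {d n : ℕ} {e : Fin (n + 2) → ℕ} {c : Fin n → ℕ}
    (h : HasMinimalResolution f d e c) {π : List ℕ} (hn : π.length = n)
    (hc : ∀ j : Fin π.length, (c (Fin.cast hn j) : ℤ) =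
      (d : ℤ) + e (Fin.cast hn j).succ.succ - 1 + π.get j) : HasPartition f d π := by
  subst hn
  exact ⟨e, c, h, hc⟩

lemma HasType.add_eq {f : S} {d t n : ℕ} (h : HasType f d t) {e : Fin (n + 2) → ℕ}
    (he : IsExponents f e) : (e 0 : ℤ) + e 1 + 1 - d = t := by
  obtain ⟨n', e', he', ht⟩ := h
  obtain ⟨hmm, hee⟩ := he.unique he'
  obtain rfl : n = n' := by omega
  obtain rfl : e = e' := funext hee
  exact ht

section
variable {f : S} {d t : ℕ} {π : List ℕ}

lemma HasClass.isExponents (h : HasClass f d t π) (hd : 1 ≤ d) :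
    ∃ e : Fin (π.length + 2) → ℕ, IsExponents f e := by
  obtain ⟨-, e, c, hres, -⟩ := h
  exact ⟨e, hres.isExponents hd⟩

/-- The degrees of the second syzygies of a curve in a given class. -/
lemma HasClass.hasMinimalResolution (h : HasClass f d t π) (hd : 1 ≤ d)
    {e : Fin (π.length + 2) → ℕ} (he : IsExponents f e) :
    HasMinimalResolution f d e (fun j => d - 1 + e j.succ.succ + π.get j) := by
  obtain ⟨-, e', c, hres, hc⟩ := h
  obtain ⟨_, hee⟩ := he.unique (hres.isExponents hd)
  obtain rfl : e = e' := funext hee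
  obtain rfl : c = fun j => d - 1 + e j.succ.succ + π.get j := by
    funext j
    have := hc j
    omega
  exact hres

/-- This is the monotonicity of the `c_j`; a drop in `π` becomes a strict gap between exponents. -/
lemma HasClass.le_of_le (h : HasClass f d t π) (hd : 1 ≤ d) {e : Fin (π.length + 2) → ℕ}
    (he : IsExponents f e) {i j : Fin π.length} (hij : i ≤ j) :
    e i.succ.succ + π.get i ≤ e j.succ.succ + π.get j := by
  have := (h.hasMinimalResolution hd he).2.1 hij
  dsimp only at this
  omega

lemma HasClass.pos (h : HasClass f d t π) (hd : 1 ≤ d) {x : ℕ} (hx : x ∈ π) : 0 < x := by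
  obtain ⟨e, he⟩ := h.isExponents hd
  have hres := h.hasMinimalResolution hd he
  obtain ⟨A, B, hA, hm, hB, hinj, hBA, hAf⟩ := hres.exists_matrices hd
  obtain ⟨j, rfl⟩ := List.get_of_mem hx
  have := lt_degree_second_syzygy he.1 hres.2.1 hA hm hB hinj hBA hAf j
  omega

lemma HasClass.numerics (h : HasClass f d t π) (hd : 1 ≤ d) (hf' : f.IsHomogeneous d)
    (hred : Squarefree f) {e : Fin (π.length + 2) → ℕ} (he : IsExponents f e) :
    π.sum = t ∧ 2 * (totalTjurina f : ℤ) = ((d : ℤ) - 1 + e 0) ^ 2 + ((d : ℤ) - 1 + e 1) ^ 2 -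
      3 * ((d : ℤ) - 1) ^ 2 + ∑ j : Fin π.length, (((d : ℤ) - 1 + e j.succ.succ) ^ 2 -
        ((d : ℤ) - 1 + e j.succ.succ + π.get j) ^ 2) := by
  have hres := h.hasMinimalResolution hd he
  obtain ⟨A, B, hA, hm, hB, hinj, hBA, hAf⟩ := hres.exists_matrices hd
  obtain ⟨-, h1, k₁, h2⟩ := resolution_numerics (by omega) hf' hred
    ((isGradedMatrix_add_iff _).mpr hA) hB hinj hBA hAf
  obtain ⟨k₂, h3⟩ := exists_totalTjurina_add (by omega) hf' hred
  have h4 := h2 (k₁ + k₂) (by omega)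
  have h5 := h3 (k₁ + k₂) (by omega)
  have ht := h.1.add_eq he
  have hsum : (π.sum : ℤ) = ∑ j : Fin π.length, (π.get j : ℤ) := by
    conv_lhs => rw [← List.ofFn_get π, List.sum_ofFn]
    push_cast
    rfl
  have hd' : ((d - 1 : ℕ) : ℤ) = (d : ℤ) - 1 := by omega
  push_cast [hd'] at h1 h4
  -- Once `e 0` and `e 1` are split off, the remaining first syzygies pair with the second syzygies.
  rw [Fin.sum_univ_succ, Fin.sum_univ_succ] at h1 h4
  simp only [Finset.sum_add_distrib, Finset.sum_sub_distrib, Fin.succ_zero_eq_one] at h1 h4 ⊢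
  refine ⟨?_, ?_⟩
  · have h6 : (π.sum : ℤ) = t := by linarith
    exact_mod_cast h6
  · zify at h5
    linarith

end

/-- Every curve of type at least four belongs to exactly one class. -/
lemma HasType.existsUnique_hasClass {f : S} {d t : ℕ} (ht : HasType f d t) (hd : 2 ≤ d)
    (hf' : f.IsHomogeneous d) (hred : Squarefree f) (ht0 : 0 < t) :
    ∃! π : List ℕ, HasClass f d t π := by
  have ht' := ht
  obtain ⟨n, e, he, het⟩ := ht'
  -- As `e 1 ≤ d - 1`, positive type forces `e 0 > 0`, which minimality of the resolution requires.
  have he1 := he.one_le (by omega) hf' hred.ne_zero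
  obtain ⟨c, hres⟩ := he.exists_hasMinimalResolution hd hf' hred (by omega)
  obtain ⟨A, B, hA, hm, hB, hinj, hBA, hAf⟩ := hres.exists_matrices (by omega)
  have hlt := lt_degree_second_syzygy he.1 hres.2.1 hA hm hB hinj hBA hAf
  refine ⟨List.ofFn fun j => c j - (d - 1 + e j.succ.succ), ⟨ht, ?_⟩, fun π hπ => ?_⟩
  · refine hasPartition_of_length_eq hres (List.length_ofFn) fun j => ?_
    have := hlt (Fin.cast List.length_ofFn j)
    rw [List.get_ofFn]
    omega
  · obtain ⟨-, e', c', hres', hc'⟩ := hπ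
    obtain ⟨hn, hee, hcc⟩ := hres'.unique hres (by omega) hf'
    subst hn
    obtain rfl : e' = e := funext hee
    obtain rfl : c' = c := funext hcc
    conv_lhs => rw [← List.ofFn_get π]
    congr 1
    funext j
    have := hc' j
    omega

lemma mem_of_sum_eq_four {π : List ℕ} (hpos : ∀ x ∈ π, 0 < x) (hsum : π.sum = 4) :
    π ∈ ([[4], [3, 1], [2, 2], [1, 3], [2, 1, 1], [1, 2, 1], [1, 1, 2], [1, 1, 1, 1]] :
      List (List ℕ)) := by
  rcases π with _ | ⟨a, _ | ⟨b, _ | ⟨c, _ | ⟨x, _ | ⟨y, l⟩⟩⟩⟩⟩ <;>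
    simp only [List.mem_cons, List.not_mem_nil, or_false, forall_eq_or_imp, List.sum_cons,
      List.sum_nil, forall_eq, List.cons.injEq, and_true, and_false, reduceCtorEq,
      false_or] at hpos hsum ⊢ <;> omega

end PlaneCurve

/-! ### The eight classes of type four -/

theorem corollary4p1 (f : PlaneCurve.S) (d : ℕ) (hd : 3 ≤ d) (hf : f.IsHomogeneous d)
    (hred : Squarefree f) (ht : PlaneCurve.HasType f d 4) :
    (∀ (n : ℕ) (e : Fin (n + 2) → ℕ), PlaneCurve.IsExponents f e → e 0 + e 1 = d + 3) ∧
    (∃! π : List ℕ, PlaneCurve.HasClass f d 4 π) ∧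
    (∀ π : List ℕ, PlaneCurve.HasClass f d 4 π →
      π ∈ ([[4], [3, 1], [2, 2], [1, 3], [2, 1, 1], [1, 2, 1], [1, 1, 2], [1, 1, 1, 1]] :
        List (List ℕ))) ∧
    (PlaneCurve.HasClass f d 4 [4] →
      PlaneCurve.IsSyzygyCurve f 3 ∧
      ∀ e : Fin 3 → ℕ, PlaneCurve.IsExponents f e →
        (PlaneCurve.totalTjurina f : ℤ) =
          (e 0 : ℤ) ^ 2 + e 0 * e 1 + (e 1 : ℤ) ^ 2 - 4 * (e 0 + e 1 + e 2)) ∧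
    (PlaneCurve.HasClass f d 4 [3, 1] →
      PlaneCurve.IsSyzygyCurve f 4 ∧
      ∀ e : Fin 4 → ℕ, PlaneCurve.IsExponents f e →
        (e 2 : ℤ) < e 3 - 1 ∧
        (PlaneCurve.totalTjurina f : ℤ) =
          (e 0 : ℤ) ^ 2 + e 0 * e 1 + (e 1 : ℤ) ^ 2 - 4 * e 0 - 4 * e 1 + 3
            - 3 * e 2 - e 3) ∧
    (PlaneCurve.HasClass f d 4 [2, 2] →
      PlaneCurve.IsSyzygyCurve f 4 ∧
      ∀ e : Fin 4 → ℕ, PlaneCurve.IsExponents f e →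
        (PlaneCurve.totalTjurina f : ℤ) =
          (e 0 : ℤ) ^ 2 + e 0 * e 1 + (e 1 : ℤ) ^ 2 - 4 * e 0 - 4 * e 1 + 4
            - 2 * e 2 - 2 * e 3) ∧
    (PlaneCurve.HasClass f d 4 [1, 3] →
      PlaneCurve.IsSyzygyCurve f 4 ∧
      ∀ e : Fin 4 → ℕ, PlaneCurve.IsExponents f e →
        (PlaneCurve.totalTjurina f : ℤ) =
          (e 0 : ℤ) ^ 2 + e 0 * e 1 + (e 1 : ℤ) ^ 2 - 4 * e 0 - 4 * e 1 + 3
            - e 2 - 3 * e 3) ∧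
    (PlaneCurve.HasClass f d 4 [2, 1, 1] →
      PlaneCurve.IsSyzygyCurve f 5 ∧
      ∀ e : Fin 5 → ℕ, PlaneCurve.IsExponents f e →
        e 2 < e 3 ∧
        (PlaneCurve.totalTjurina f : ℤ) =
          (e 0 : ℤ) ^ 2 + e 0 * e 1 + (e 1 : ℤ) ^ 2 - 4 * e 0 - 4 * e 1 + 5
            - 2 * e 2 - e 3 - e 4) ∧
    (PlaneCurve.HasClass f d 4 [1, 2, 1] →
      PlaneCurve.IsSyzygyCurve f 5 ∧
      ∀ e : Fin 5 → ℕ, PlaneCurve.IsExponents f e →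
        e 3 < e 4 ∧
        (PlaneCurve.totalTjurina f : ℤ) =
          (e 0 : ℤ) ^ 2 + e 0 * e 1 + (e 1 : ℤ) ^ 2 - 4 * e 0 - 4 * e 1 + 5
            - e 2 - 2 * e 3 - e 4) ∧
    (PlaneCurve.HasClass f d 4 [1, 1, 2] →
      PlaneCurve.IsSyzygyCurve f 5 ∧
      ∀ e : Fin 5 → ℕ, PlaneCurve.IsExponents f e →
        (PlaneCurve.totalTjurina f : ℤ) =
          (e 0 : ℤ) ^ 2 + e 0 * e 1 + (e 1 : ℤ) ^ 2 - 4 * e 0 - 4 * e 1 + 5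
            - e 2 - e 3 - 2 * e 4) ∧
    (PlaneCurve.HasClass f d 4 [1, 1, 1, 1] →
      PlaneCurve.IsSyzygyCurve f 6 ∧
      ∀ e : Fin 6 → ℕ, PlaneCurve.IsExponents f e →
        (PlaneCurve.totalTjurina f : ℤ) =
          (e 0 : ℤ) ^ 2 + e 0 * e 1 + (e 1 : ℤ) ^ 2 - 4 * e 0 - 4 * e 1 + 6
            - (e 2 + e 3 + e 4 + e 5)) := by
  have hd1 : 1 ≤ d := by omega
  have hsum : ∀ (n : ℕ) (e : Fin (n + 2) → ℕ), PlaneCurve.IsExponents f e →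
      e 0 + e 1 = d + 3 := by
    intro n e he
    have := ht.add_eq he
    omega
  have hmem : ∀ π : List ℕ, PlaneCurve.HasClass f d 4 π →
      π ∈ ([[4], [3, 1], [2, 2], [1, 3], [2, 1, 1], [1, 2, 1], [1, 1, 2], [1, 1, 1, 1]] :
        List (List ℕ)) := by
    intro π hπ
    obtain ⟨e, he⟩ := hπ.isExponents hd1
    exact PlaneCurve.mem_of_sum_eq_four (fun x hx => hπ.pos hd1 hx)
      (hπ.numerics hd1 hf hred he).1
  refine ⟨hsum, ht.existsUnique_hasClass (by omega) hf hred (by omega), hmem,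
    ?_, ?_, ?_, ?_, ?_, ?_, ?_, ?_⟩
  · intro h
    refine ⟨h.isExponents hd1, fun e he => ?_⟩
    have h0 := hsum _ e he
    have hτ := (h.numerics hd1 hf hred he).2
    have hd0 : (d : ℤ) = e 0 + e 1 - 3 := by omega
    -- The sum over `π` is unfolded with its entries evaluated; substituting `d = e 0 + e 1 - 3`
    -- then gives the formula. The other classes follow the same pattern.
    replace hτ : 2 * (PlaneCurve.totalTjurina f : ℤ) = ((d : ℤ) - 1 + e 0) ^ 2 +
        ((d : ℤ) - 1 + e 1) ^ 2 - 3 * ((d : ℤ) - 1) ^ 2 +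
        ((((d : ℤ) - 1 + e 2) ^ 2 - ((d : ℤ) - 1 + e 2 + 4) ^ 2)) := by
      refine hτ.trans ?_
      congr 1
      exact Fin.sum_univ_one _
    rw [hd0] at hτ
    linarith
  · intro h
    refine ⟨h.isExponents hd1, fun e he => ?_⟩
    have h0 := hsum _ e he
    have hτ := (h.numerics hd1 hf hred he).2
    have hd0 : (d : ℤ) = e 0 + e 1 - 3 := by omega
    replace hτ : 2 * (PlaneCurve.totalTjurina f : ℤ) = ((d : ℤ) - 1 + e 0) ^ 2 +
        ((d : ℤ) - 1 + e 1) ^ 2 - 3 * ((d : ℤ) - 1) ^ 2 +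
        ((((d : ℤ) - 1 + e 2) ^ 2 - ((d : ℤ) - 1 + e 2 + 3) ^ 2) +
          (((d : ℤ) - 1 + e 3) ^ 2 - ((d : ℤ) - 1 + e 3 + 1) ^ 2)) := by
      refine hτ.trans ?_
      congr 1
      exact Fin.sum_univ_two _
    rw [hd0] at hτ
    have hle := h.le_of_le hd1 he (i := (0 : Fin 2)) (j := (1 : Fin 2)) (by decide)
    -- This is `c_1 ≤ c_2`, with the common shift `d - 1` cancelled.
    change e 2 + 3 ≤ e 3 + 1 at hle
    refine ⟨by omega, ?_⟩
    linarith
  · intro h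
    refine ⟨h.isExponents hd1, fun e he => ?_⟩
    have h0 := hsum _ e he
    have hτ := (h.numerics hd1 hf hred he).2
    have hd0 : (d : ℤ) = e 0 + e 1 - 3 := by omega
    replace hτ : 2 * (PlaneCurve.totalTjurina f : ℤ) = ((d : ℤ) - 1 + e 0) ^ 2 +
        ((d : ℤ) - 1 + e 1) ^ 2 - 3 * ((d : ℤ) - 1) ^ 2 +
        ((((d : ℤ) - 1 + e 2) ^ 2 - ((d : ℤ) - 1 + e 2 + 2) ^ 2) +
          (((d : ℤ) - 1 + e 3) ^ 2 - ((d : ℤ) - 1 + e 3 + 2) ^ 2)) := by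
      refine hτ.trans ?_
      congr 1
      exact Fin.sum_univ_two _
    rw [hd0] at hτ
    linarith
  · intro h
    refine ⟨h.isExponents hd1, fun e he => ?_⟩
    have h0 := hsum _ e he
    have hτ := (h.numerics hd1 hf hred he).2
    have hd0 : (d : ℤ) = e 0 + e 1 - 3 := by omega
    replace hτ : 2 * (PlaneCurve.totalTjurina f : ℤ) = ((d : ℤ) - 1 + e 0) ^ 2 +
        ((d : ℤ) - 1 + e 1) ^ 2 - 3 * ((d : ℤ) - 1) ^ 2 +
        ((((d : ℤ) - 1 + e 2) ^ 2 - ((d : ℤ) - 1 + e 2 + 1) ^ 2) +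
          (((d : ℤ) - 1 + e 3) ^ 2 - ((d : ℤ) - 1 + e 3 + 3) ^ 2)) := by
      refine hτ.trans ?_
      congr 1
      exact Fin.sum_univ_two _
    rw [hd0] at hτ
    linarith
  · intro h
    refine ⟨h.isExponents hd1, fun e he => ?_⟩
    have h0 := hsum _ e he
    have hτ := (h.numerics hd1 hf hred he).2
    have hd0 : (d : ℤ) = e 0 + e 1 - 3 := by omega
    replace hτ : 2 * (PlaneCurve.totalTjurina f : ℤ) = ((d : ℤ) - 1 + e 0) ^ 2 +
        ((d : ℤ) - 1 + e 1) ^ 2 - 3 * ((d : ℤ) - 1) ^ 2 +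
        ((((d : ℤ) - 1 + e 2) ^ 2 - ((d : ℤ) - 1 + e 2 + 2) ^ 2) +
          (((d : ℤ) - 1 + e 3) ^ 2 - ((d : ℤ) - 1 + e 3 + 1) ^ 2) +
          (((d : ℤ) - 1 + e 4) ^ 2 - ((d : ℤ) - 1 + e 4 + 1) ^ 2)) := by
      refine hτ.trans ?_
      congr 1
      exact Fin.sum_univ_three _
    rw [hd0] at hτ
    have hle := h.le_of_le hd1 he (i := (0 : Fin 3)) (j := (1 : Fin 3)) (by decide)
    change e 2 + 2 ≤ e 3 + 1 at hle
    refine ⟨by omega, ?_⟩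
    linarith
  · intro h
    refine ⟨h.isExponents hd1, fun e he => ?_⟩
    have h0 := hsum _ e he
    have hτ := (h.numerics hd1 hf hred he).2
    have hd0 : (d : ℤ) = e 0 + e 1 - 3 := by omega
    replace hτ : 2 * (PlaneCurve.totalTjurina f : ℤ) = ((d : ℤ) - 1 + e 0) ^ 2 +
        ((d : ℤ) - 1 + e 1) ^ 2 - 3 * ((d : ℤ) - 1) ^ 2 +
        ((((d : ℤ) - 1 + e 2) ^ 2 - ((d : ℤ) - 1 + e 2 + 1) ^ 2) +
          (((d : ℤ) - 1 + e 3) ^ 2 - ((d : ℤ) - 1 + e 3 + 2) ^ 2) +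
          (((d : ℤ) - 1 + e 4) ^ 2 - ((d : ℤ) - 1 + e 4 + 1) ^ 2)) := by
      refine hτ.trans ?_
      congr 1
      exact Fin.sum_univ_three _
    rw [hd0] at hτ
    have hle := h.le_of_le hd1 he (i := (1 : Fin 3)) (j := (2 : Fin 3)) (by decide)
    change e 3 + 2 ≤ e 4 + 1 at hle
    refine ⟨by omega, ?_⟩
    linarith
  · intro h
    refine ⟨h.isExponents hd1, fun e he => ?_⟩
    have h0 := hsum _ e he
    have hτ := (h.numerics hd1 hf hred he).2
    have hd0 : (d : ℤ) = e 0 + e 1 - 3 := by omega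
    replace hτ : 2 * (PlaneCurve.totalTjurina f : ℤ) = ((d : ℤ) - 1 + e 0) ^ 2 +
        ((d : ℤ) - 1 + e 1) ^ 2 - 3 * ((d : ℤ) - 1) ^ 2 +
        ((((d : ℤ) - 1 + e 2) ^ 2 - ((d : ℤ) - 1 + e 2 + 1) ^ 2) +
          (((d : ℤ) - 1 + e 3) ^ 2 - ((d : ℤ) - 1 + e 3 + 1) ^ 2) +
          (((d : ℤ) - 1 + e 4) ^ 2 - ((d : ℤ) - 1 + e 4 + 2) ^ 2)) := by
      refine hτ.trans ?_
      congr 1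
      exact Fin.sum_univ_three _
    rw [hd0] at hτ
    linarith
  · intro h
    refine ⟨h.isExponents hd1, fun e he => ?_⟩
    have h0 := hsum _ e he
    have hτ := (h.numerics hd1 hf hred he).2
    have hd0 : (d : ℤ) = e 0 + e 1 - 3 := by omega
    replace hτ : 2 * (PlaneCurve.totalTjurina f : ℤ) = ((d : ℤ) - 1 + e 0) ^ 2 +
        ((d : ℤ) - 1 + e 1) ^ 2 - 3 * ((d : ℤ) - 1) ^ 2 +
        ((((d : ℤ) - 1 + e 2) ^ 2 - ((d : ℤ) - 1 + e 2 + 1) ^ 2) +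
          (((d : ℤ) - 1 + e 3) ^ 2 - ((d : ℤ) - 1 + e 3 + 1) ^ 2) +
          (((d : ℤ) - 1 + e 4) ^ 2 - ((d : ℤ) - 1 + e 4 + 1) ^ 2) +
          (((d : ℤ) - 1 + e 5) ^ 2 - ((d : ℤ) - 1 + e 5 + 1) ^ 2)) := by
      refine hτ.trans ?_
      congr 1
      exact Fin.sum_univ_four _
    rw [hd0] at hτ
    linarith
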